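/- Let $N$ be a free abelian group of finite rank $n\ge 1$, and let $\Sigma$ be a fan in $N_{\mathbb Q}=N\otimes_{\mathbb Z}\mathbb Q$, i.e. a finite nonempty collection of strongly convex rational polyhedral cones that contains every face of each of its members and in which any two members meet in a common face of both. Let $X_\Sigma$ be the toric variety over $\mathbb C$ defined by $\Sigma$, obtained by gluing the affine varieties $\operatorname{Spec}\mathbb C[\sigma^\vee\cap \operatorname{Hom}(N,\mathbb Z)]$, $\sigma\in\Sigma$, along those of common faces. Let $G(\Sigma)\subset N$ be the set of the primitive generators of the semigroups $\sigma\cap N$, where $\sigma$ runs over the one-dimensional cones of $\Sigma$. A nonempty set $\{x_1,\dots,x_k\}\subset G(\Sigma)$ of $k$ elements is called a primitive collection if for each $i$ the elements of $\{x_1,\dots,x_k\}\setminus\{x_i\}$ generate a $(k-1)$-dimensional cone belonging to $\Sigma$, while $\{x_1,\dots,x_k\}$ does not generate a $k$-dimensional cone belonging to $\Sigma$. If $X_\Sigma$ is smooth and projective over $\mathbb C$ (that is, $\Sigma$ defines a projective toric manifold), then there is a primitive collection $\{x_1,\dots,x_k\}$ with $$x_1+\cdots+x_k=0 .$$ -/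

import Mathlib

open CategoryTheory CategoryTheory.Limits AlgebraicGeometry
open scoped TensorProduct

noncomputable section

namespace Toric

/-! ### Cones and fans in `N_ℚ = ℚ ⊗ N`, where `N` is a lattice -/

section Cones

variable {N : Type} [AddCommGroup N]

/-- The rational extension `N_ℚ → ℚ` of a character `m ∈ M = Hom(N, ℤ)`. -/
def pair (m : N →ₗ[ℤ] ℤ) : ℚ ⊗[ℤ] N →ₗ[ℚ] ℚ :=
  LinearMap.liftBaseChange ℚ (Algebra.linearMap ℤ ℚ ∘ₗ m)

@[simp] lemma pair_tmul (m : N →ₗ[ℤ] ℤ) (q : ℚ) (x : N) : pair m (q ⊗ₜ[ℤ] x) = q * (m x : ℚ) := by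
  simp [pair]

lemma pair_add (m m' : N →ₗ[ℤ] ℤ) (v : ℚ ⊗[ℤ] N) : pair (m + m') v = pair m v + pair m' v := by
  have h : pair (m + m') = pair m + pair m' := by
    refine TensorProduct.AlgebraTensorModule.ext fun q x => ?_
    simp [mul_add]
  rw [h]; rfl

lemma pair_zero (v : ℚ ⊗[ℤ] N) : pair (0 : N →ₗ[ℤ] ℤ) v = 0 := by
  have h : pair (0 : N →ₗ[ℤ] ℤ) = 0 := by
    refine TensorProduct.AlgebraTensorModule.ext fun q x => ?_
    simp
  rw [h]; rfl

/-- The convex cone in `N_ℚ` generated by a set of lattice vectors. -/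
def coneOf (S : Set N) : PointedCone ℚ (ℚ ⊗[ℤ] N) :=
  PointedCone.hull ℚ ((fun x : N => (1 : ℚ) ⊗ₜ[ℤ] x) '' S)

/-- The dimension of a cone: the dimension of its linear span. -/
def coneDim (σ : PointedCone ℚ (ℚ ⊗[ℤ] N)) : ℕ :=
  Module.finrank ℚ (Submodule.span ℚ (σ : Set (ℚ ⊗[ℤ] N)))

/-- The semigroup `σ^∨ ∩ M` of characters that are nonnegative on `σ`. -/
def dualMonoid (σ : PointedCone ℚ (ℚ ⊗[ℤ] N)) : AddSubmonoid (N →ₗ[ℤ] ℤ) where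
  carrier := {m | ∀ v ∈ σ, 0 ≤ pair m v}
  zero_mem' := fun v _ => by rw [pair_zero]
  add_mem' := fun {a b} ha hb v hv => by rw [pair_add]; exact add_nonneg (ha v hv) (hb v hv)

lemma dualMonoid_anti {σ τ : PointedCone ℚ (ℚ ⊗[ℤ] N)} (h : σ ≤ τ) :
    dualMonoid τ ≤ dualMonoid σ := fun _ hm v hv => hm v (h hv)

/-- `τ` is a face of `σ`: it is cut out of `σ` by the hyperplane `m = 0` for some
`m ∈ σ^∨ ∩ M`. (A functional in `σ^∨ ⊆ M_ℚ` has a positive multiple in `M`.) -/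
def IsFace (τ σ : PointedCone ℚ (ℚ ⊗[ℤ] N)) : Prop :=
  ∃ m ∈ dualMonoid σ, ∀ v, v ∈ τ ↔ v ∈ σ ∧ pair m v = 0

end Cones

/-- A (finite, nonempty) fan in `N_ℚ`. -/
structure Fan (N : Type) [AddCommGroup N] where
  /-- the set of cones of the fan -/
  cones : Set (PointedCone ℚ (ℚ ⊗[ℤ] N))
  finite : cones.Finite
  nonempty : cones.Nonempty
  /-- the cones are rational polyhedral -/
  polyhedral : ∀ σ ∈ cones, ∃ S : Finset N, σ = coneOf (S : Set N)
  /-- the cones are strongly convex -/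
  stronglyConvex : ∀ σ ∈ cones, ∀ v ∈ σ, -v ∈ σ → v = 0
  face_mem : ∀ σ ∈ cones, ∀ τ, IsFace τ σ → τ ∈ cones
  inter_isFace : ∀ σ ∈ cones, ∀ τ ∈ cones, IsFace (σ ⊓ τ) σ ∧ IsFace (σ ⊓ τ) τ

/-! ### Affine toric varieties -/

section Affine

variable {N : Type} [AddCommGroup N]

/-- The coordinate ring `ℂ[σ^∨ ∩ M]` of the affine toric variety `U_σ`. -/
abbrev CoordRing (σ : PointedCone ℚ (ℚ ⊗[ℤ] N)) : Type :=
  AddMonoidAlgebra ℂ (dualMonoid σ)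

/-- The inclusion `ℂ[τ^∨ ∩ M] ⊆ ℂ[σ^∨ ∩ M]` for `σ ⊆ τ`. -/
def coordMap {σ τ : PointedCone ℚ (ℚ ⊗[ℤ] N)} (h : σ ≤ τ) : CoordRing τ →+* CoordRing σ :=
  AddMonoidAlgebra.mapDomainRingHom ℂ (AddSubmonoid.inclusion (dualMonoid_anti h))

lemma coordMap_single {σ τ : PointedCone ℚ (ℚ ⊗[ℤ] N)} (h : σ ≤ τ) (m : dualMonoid τ) (c : ℂ) :
    coordMap h (AddMonoidAlgebra.single m c) =
      AddMonoidAlgebra.single (AddSubmonoid.inclusion (dualMonoid_anti h) m) c := by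
  simp [coordMap]

lemma coordMap_injective {σ τ : PointedCone ℚ (ℚ ⊗[ℤ] N)} (h : σ ≤ τ) :
    Function.Injective (coordMap h) :=
  AddMonoidAlgebra.mapDomain_injective (AddSubmonoid.inclusion_injective _)

lemma coordMap_refl (σ : PointedCone ℚ (ℚ ⊗[ℤ] N)) : coordMap (le_refl σ) = RingHom.id _ := by
  refine AddMonoidAlgebra.ringHom_ext (fun r => ?_) (fun m => ?_) <;>
    rw [coordMap_single] <;> rfl

lemma coordMap_comp {ρ σ τ : PointedCone ℚ (ℚ ⊗[ℤ] N)} (h : ρ ≤ σ) (h' : σ ≤ τ) :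
    (coordMap h).comp (coordMap h') = coordMap (h.trans h') := by
  refine AddMonoidAlgebra.ringHom_ext (fun r => ?_) (fun m => ?_) <;>
    simp [coordMap_single, AddSubmonoid.inclusion]

lemma exists_nsmul_add_mem {σ τ : PointedCone ℚ (ℚ ⊗[ℤ] N)}
    (hσ : ∃ S : Finset N, σ = coneOf (S : Set N)) {m : N →ₗ[ℤ] ℤ} (hm : m ∈ dualMonoid σ)
    (hτ : ∀ v, v ∈ τ ↔ v ∈ σ ∧ pair m v = 0) {u : N →ₗ[ℤ] ℤ} (hu : u ∈ dualMonoid τ) :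
    ∃ k : ℕ, u + k • m ∈ dualMonoid σ := by
  obtain ⟨S, rfl⟩ := hσ
  have hmem : ∀ s ∈ S, (1 : ℚ) ⊗ₜ[ℤ] s ∈ coneOf (S : Set N) := fun s hs =>
    PointedCone.subset_hull ⟨s, hs, rfl⟩
  have key : ∀ s ∈ S, -(((∑ t ∈ S, (u t).natAbs : ℕ) : ℤ) * m s) ≤ u s := by
    intro s hs
    have h1 : 0 ≤ m s := by
      have := hm _ (hmem s hs)
      simpa using this
    rcases h1.eq_or_lt with h0 | h0
    · have : 0 ≤ pair u ((1 : ℚ) ⊗ₜ[ℤ] s) :=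
        hu _ ((hτ _).2 ⟨hmem s hs, by simp [← h0]⟩)
      have h2 : 0 ≤ u s := by simpa using this
      rw [← h0]; simpa using h2
    · have h2 : ((u s).natAbs : ℤ) ≤ ((∑ t ∈ S, (u t).natAbs : ℕ) : ℤ) := by
        exact_mod_cast Finset.single_le_sum (f := fun t => (u t).natAbs)
          (fun _ _ => Nat.zero_le _) hs
      have h3 : -u s ≤ ((u s).natAbs : ℤ) := by omega
      nlinarith
  refine ⟨∑ t ∈ S, (u t).natAbs, fun v hv => ?_⟩
  induction hv using Submodule.span_induction with
  | mem x hx =>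
    obtain ⟨s, hs, rfl⟩ := hx
    have := key s hs
    simp only [pair_tmul, one_mul]
    have h4 : (0 : ℤ) ≤ (u + (∑ t ∈ S, (u t).natAbs) • m) s := by
      simp only [LinearMap.add_apply, LinearMap.smul_apply, nsmul_eq_mul]
      linarith
    exact_mod_cast h4
  | zero => simp
  | add x y _ _ hx hy => rw [map_add]; exact add_nonneg hx hy
  | smul a x _ hx =>
    have : a • x = (a : ℚ) • x := rfl
    rw [this, map_smul]
    exact mul_nonneg a.2 hx

/-- If `τ` is the face of `σ` cut out by `m`, then `ℂ[τ^∨ ∩ M]` is the localization of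
`ℂ[σ^∨ ∩ M]` at `χ^m`. -/
lemma isLocalization_coordMap {σ τ : PointedCone ℚ (ℚ ⊗[ℤ] N)}
    (hσ : ∃ S : Finset N, σ = coneOf (S : Set N)) {m : N →ₗ[ℤ] ℤ} (hm : m ∈ dualMonoid σ)
    (hτ : ∀ v, v ∈ τ ↔ v ∈ σ ∧ pair m v = 0) (h : τ ≤ σ) :
    letI := (coordMap h).toAlgebra
    IsLocalization.Away (AddMonoidAlgebra.single (⟨m, hm⟩ : dualMonoid σ) (1 : ℂ))
      (CoordRing τ) := by
  let := (coordMap h).toAlgebra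
  have halg : ∀ x, algebraMap (CoordRing σ) (CoordRing τ) x = coordMap h x := fun _ => rfl
  have hneg : -m ∈ dualMonoid τ := fun v hv => by
    have h1 := pair_add m (-m) v
    rw [add_neg_cancel, pair_zero, ((hτ v).1 hv).2] at h1
    linarith
  have hsurj : ∀ z : CoordRing τ, ∃ (k : ℕ) (y : CoordRing σ),
      z * coordMap h (AddMonoidAlgebra.single (⟨m, hm⟩ : dualMonoid σ) (1 : ℂ) ^ k) =
        coordMap h y := by
    intro z
    induction z using AddMonoidAlgebra.induction_linear with
    | zero => exact ⟨0, 0, by simp⟩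
    | add x y hx hy =>
      obtain ⟨k, a, ha⟩ := hx
      obtain ⟨l, b, hb⟩ := hy
      refine ⟨k + l, a * AddMonoidAlgebra.single (⟨m, hm⟩ : dualMonoid σ) (1 : ℂ) ^ l +
        b * AddMonoidAlgebra.single (⟨m, hm⟩ : dualMonoid σ) (1 : ℂ) ^ k, ?_⟩
      rw [map_add, map_mul, map_mul, ← ha, ← hb, pow_add, map_mul]
      ring
    | single u c =>
      obtain ⟨k, hk⟩ := exists_nsmul_add_mem hσ hm hτ u.2
      refine ⟨k, AddMonoidAlgebra.single ⟨_, hk⟩ c, ?_⟩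
      rw [AddMonoidAlgebra.single_pow, coordMap_single, coordMap_single,
        AddMonoidAlgebra.single_mul_single]
      simp only [one_pow, mul_one]
      congr 1
  refine IsLocalization.Away.mk _ ?_ ?_ ?_
  · rw [halg, coordMap_single]
    refine IsUnit.of_mul_eq_one (AddMonoidAlgebra.single ⟨-m, hneg⟩ 1) ?_
    rw [AddMonoidAlgebra.single_mul_single, AddMonoidAlgebra.one_def, mul_one]
    congr 1
    ext1
    exact add_neg_cancel m
  · intro z
    obtain ⟨k, y, hy⟩ := hsurj z
    exact ⟨k, y, by rw [halg, halg, ← map_pow]; exact hy⟩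
  · intro a b hab
    exact ⟨0, by rw [coordMap_injective h hab]⟩

/-- The open immersion `U_τ ⟶ U_σ` for `τ ⊆ σ`, dual to `ℂ[σ^∨ ∩ M] ⊆ ℂ[τ^∨ ∩ M]`. -/
def affineMap {σ τ : PointedCone ℚ (ℚ ⊗[ℤ] N)} (h : τ ≤ σ) :
    Spec (CommRingCat.of (CoordRing τ)) ⟶ Spec (CommRingCat.of (CoordRing σ)) :=
  Spec.map (CommRingCat.ofHom (coordMap h))

lemma isOpenImmersion_affineMap {σ τ : PointedCone ℚ (ℚ ⊗[ℤ] N)}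
    (hσ : ∃ S : Finset N, σ = coneOf (S : Set N)) (hτ : IsFace τ σ) (h : τ ≤ σ) :
    IsOpenImmersion (affineMap h) := by
  obtain ⟨m, hm, hmτ⟩ := hτ
  let := (coordMap h).toAlgebra
  have := isLocalization_coordMap hσ hm hmτ h
  exact IsOpenImmersion.of_isLocalization
    (AddMonoidAlgebra.single (⟨m, hm⟩ : dualMonoid σ) (1 : ℂ))

lemma range_affineMap {σ τ : PointedCone ℚ (ℚ ⊗[ℤ] N)}
    (hσ : ∃ S : Finset N, σ = coneOf (S : Set N)) {m : N →ₗ[ℤ] ℤ} (hm : m ∈ dualMonoid σ)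
    (hτ : ∀ v, v ∈ τ ↔ v ∈ σ ∧ pair m v = 0) (h : τ ≤ σ) :
    Set.range (affineMap h) =
      {p | AddMonoidAlgebra.single (⟨m, hm⟩ : dualMonoid σ) (1 : ℂ) ∉ p.asIdeal} := by
  let := (coordMap h).toAlgebra
  have := isLocalization_coordMap hσ hm hτ h
  exact PrimeSpectrum.localization_away_comap_range (CoordRing τ)
    (AddMonoidAlgebra.single (⟨m, hm⟩ : dualMonoid σ) (1 : ℂ))

end Affine

/-! ### The toric variety of a fan -/

namespace Fan

variable {N : Type} [AddCommGroup N] (F : Fan N)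

lemma isFace_of_le {σ τ : F.cones} (h : τ ≤ σ) : IsFace τ.1 σ.1 := by
  have h1 := (F.inter_isFace σ.1 σ.2 τ.1 τ.2).1
  have h2 : τ.1 ≤ σ.1 := h
  rwa [inf_eq_right.2 h2] at h1

/-- The diagram of the affine toric varieties `U_σ`, indexed by the cones of the fan ordered by
inclusion (equivalently, by the face relation). -/
def diagram : F.cones ⥤ Scheme.{0} where
  obj σ := Spec (CommRingCat.of (CoordRing σ.1))
  map f := affineMap (leOfHom f)
  map_id σ := by
    rw [affineMap, coordMap_refl]
    exact Spec.map_id _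
  map_comp f g := by
    rw [affineMap, affineMap, affineMap, ← Spec.map_comp, ← CommRingCat.ofHom_comp, coordMap_comp]

instance {σ τ : F.cones} (f : τ ⟶ σ) : IsOpenImmersion (F.diagram.map f) :=
  isOpenImmersion_affineMap (F.polyhedral _ σ.2) (F.isFace_of_le (leOfHom f)) (leOfHom f)

instance : (F.diagram ⋙ Scheme.forget).IsLocallyDirected := by
  constructor
  intro i j k fi fj xi xj hx
  have hi : i.1 ≤ k.1 := leOfHom fi
  have hj : j.1 ≤ k.1 := leOfHom fj
  obtain ⟨m, hm, hmi⟩ := F.isFace_of_le (leOfHom fi)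
  obtain ⟨m', hm', hmj⟩ := F.isFace_of_le (leOfHom fj)
  have hl : IsFace (i.1 ⊓ j.1) i.1 := (F.inter_isFace _ i.2 _ j.2).1
  let l : F.cones := ⟨i.1 ⊓ j.1, F.face_mem _ i.2 _ hl⟩
  let gi : l ⟶ i := homOfLE (show i.1 ⊓ j.1 ≤ i.1 from inf_le_left)
  let gj : l ⟶ j := homOfLE (show i.1 ⊓ j.1 ≤ j.1 from inf_le_right)
  have hmm : ∀ v, v ∈ i.1 ⊓ j.1 ↔ v ∈ k.1 ∧ pair (m + m') v = 0 := by
    intro v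
    rw [Submodule.mem_inf, hmi, hmj, pair_add]
    constructor
    · rintro ⟨⟨h1, h2⟩, _, h3⟩
      exact ⟨h1, by rw [h2, h3, add_zero]⟩
    · rintro ⟨h1, h2⟩
      have h3 := hm v h1
      have h4 := hm' v h1
      exact ⟨⟨h1, by linarith⟩, h1, by linarith⟩
  have hk := F.polyhedral _ k.2
  have hxi : F.diagram.map fi xi ∈ Set.range (affineMap hi) := ⟨xi, rfl⟩
  have hxj : F.diagram.map fi xi ∈ Set.range (affineMap hj) := ⟨xj, hx.symm⟩
  rw [range_affineMap hk hm hmi] at hxi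
  rw [range_affineMap hk hm' hmj] at hxj
  have hxl : F.diagram.map fi xi ∈ Set.range (affineMap (show i.1 ⊓ j.1 ≤ k.1 from inf_le_left.trans hi)) := by
    rw [range_affineMap hk (add_mem hm hm') hmm]
    intro hmem
    have h1 : AddMonoidAlgebra.single (⟨m + m', add_mem hm hm'⟩ : dualMonoid k.1) (1 : ℂ) =
        AddMonoidAlgebra.single ⟨m, hm⟩ 1 * AddMonoidAlgebra.single ⟨m', hm'⟩ 1 := by
      rw [AddMonoidAlgebra.single_mul_single, mul_one]
      rfl
    rw [h1] at hmem
    exact ((F.diagram.map fi xi).2.mem_or_mem hmem).elim hxi hxj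
  obtain ⟨x, hxx⟩ : ∃ x : F.diagram.obj l, F.diagram.map (gi ≫ fi) x = F.diagram.map fi xi := hxl
  have e1 : F.diagram.map fi (F.diagram.map gi x) = F.diagram.map fi xi := by
    rw [← hxx, Functor.map_comp, Scheme.Hom.comp_apply]
  have e2 : F.diagram.map fj (F.diagram.map gj x) = F.diagram.map fj xj := by
    have h2 : F.diagram.map (gj ≫ fj) x = F.diagram.map fj xj := hxx.trans hx
    rw [← h2, Functor.map_comp, Scheme.Hom.comp_apply]
  exact ⟨l, gi, gj, x, (F.diagram.map fi).isOpenEmbedding.injective e1,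
    (F.diagram.map fj).isOpenEmbedding.injective e2⟩

/-- The toric variety `X_Σ`: the affine toric varieties `U_σ`, glued along the open subschemes
`U_τ` for the common faces `τ`. -/
def toricVariety : Scheme.{0} := colimit F.diagram

/-- The structure morphism `X_Σ ⟶ Spec ℂ`. -/
def structureMorphism : F.toricVariety ⟶ Spec (CommRingCat.of ℂ) :=
  colimit.desc F.diagram
    { pt := Spec (CommRingCat.of ℂ)
      ι :=
        { app := fun σ => Spec.map (CommRingCat.ofHom (algebraMap ℂ (CoordRing σ.1)))
          naturality := fun σ τ f => by
            simp only [diagram, affineMap, Functor.const_obj_obj, Functor.const_obj_map,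
              Category.comp_id]
            rw [← Spec.map_comp, ← CommRingCat.ofHom_comp]
            congr 2
            ext c
            simp [coordMap_single] } }

end Fan

/-! ### Projective schemes over `ℂ` -/

attribute [local instance] MvPolynomial.gradedAlgebra

/-- Projective space `ℙ^r` over `ℂ`. -/
def projectiveSpace (r : ℕ) : Scheme.{0} :=
  Proj (MvPolynomial.homogeneousSubmodule (Fin (r + 1)) ℂ)

/-- The structure morphism `ℙ^r ⟶ Spec ℂ`. -/
def projectiveSpaceMorphism (r : ℕ) : projectiveSpace r ⟶ Spec (CommRingCat.of ℂ) :=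
  Proj.toSpecZero (MvPolynomial.homogeneousSubmodule (Fin (r + 1)) ℂ) ≫
    Spec.map (CommRingCat.ofHom
      (algebraMap ℂ (MvPolynomial.homogeneousSubmodule (Fin (r + 1)) ℂ 0)))

/-- A scheme over `ℂ` is projective if it is isomorphic to a closed subscheme of some `ℙ^r`. -/
def IsProjective {X : Scheme.{0}} (f : X ⟶ Spec (CommRingCat.of ℂ)) : Prop :=
  ∃ (r : ℕ) (i : X ⟶ projectiveSpace r), IsClosedImmersion i ∧ i ≫ projectiveSpaceMorphism r = f

/-! ### Primitive collections -/

namespace Fan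

variable {N : Type} [AddCommGroup N] (F : Fan N)

/-- `F` defines a projective toric manifold: `X_Σ` is smooth and projective over `ℂ`. -/
def DefinesProjectiveManifold : Prop :=
  Smooth F.structureMorphism ∧ IsProjective F.structureMorphism

/-- The set `G(Σ)` of primitive generators of the one-dimensional cones: `x ∈ G(Σ)` if, for some
one-dimensional `σ ∈ Σ`, the semigroup `σ ∩ N` consists of the multiples `0, x, 2x, …`. -/
def generators : Set N :=
  {x | ∃ σ ∈ F.cones, coneDim σ = 1 ∧ ∀ y : N, (1 : ℚ) ⊗ₜ[ℤ] y ∈ σ ↔ ∃ k : ℕ, y = k • x}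

/-- The set `S` generates a `d`-dimensional cone that belongs to the fan. -/
def GeneratesCone (S : Set N) (d : ℕ) : Prop :=
  coneOf S ∈ F.cones ∧ coneDim (coneOf S) = d

/-- `P = {x₁, …, x_k} ⊆ G(Σ)` is a primitive collection. -/
structure IsPrimitiveCollection (P : Finset N) : Prop where
  nonempty : P.Nonempty
  subset_generators : (P : Set N) ⊆ F.generators
  generates : ∀ x ∈ P, F.GeneratesCone ((P : Set N) \ {x}) (P.card - 1)
  not_generates : ¬ F.GeneratesCone (P : Set N) P.card

end Fan

end Toric

end

/-!
The proof is Batyrev's. Since `X_Σ` is proper, the valuative criterion for one-parameter subgroups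
shows that the cones of `Σ` cover the lattice (`Fan.exists_mem_of_isProper`), and already the
full-dimensional cones do (`Fan.exists_isFull_mem`). Since `X_Σ` is smooth, each full-dimensional
cone is generated by a basis of `N` (`exists_basis_of_formallySmooth`): infinitesimal lifting shows
that the indecomposable elements of `σ^∨ ∩ M` satisfy no relation. Since `X_Σ` is projective, there
is a function `φ : N → ℤ` that is concave, linear on each full-dimensional cone, and strictly concave
across different ones (`Fan.exists_strictlyConcave`).

Given these, consider the nonempty multisets of elements of `G(Σ)` with sum `0`; they exist because
`Σ` is complete and regular. Concavity bounds `∑ φ x` over such a multiset by `φ 0 = 0`, so some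
multiset `A` attains the maximum. Its elements do not lie in a common cone, so `A` contains a
primitive collection `P`. Replace `P` in `A` by the expansion of `∑ x ∈ P, x` in the basis of a cone
that contains it. As `P` is not contained in a cone, strict concavity makes `∑ φ x` larger, so the
new multiset must be empty. Hence `A = P` and `∑ x ∈ P, x = 0`
(`Fan.exists_isPrimitiveCollection_sum_eq_zero`).

The function `φ` comes from the homogeneous coordinates of an embedding into projective space. On
the torus, after clearing denominators and common factors, they are coprime Laurent polynomials
`f k` (`Fan.exists_homogeneous_coordinates`; the Laurent polynomial ring is factorial), and `φ v` is
the least value at `v` of an exponent of the `f k`. At the torus-fixed point of the chart of a full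
cone `σ`, all `f k / f j` are regular for some `j`; by coprimality `f j` contains a monomial `m`
such that `t - m ∈ σ^∨` for all exponents `t` of the `f k`, so `φ = m` on `σ`. As the embedding is
surjective on stalks, each character in `σ^∨ ∩ M` is a ratio of forms in the `f k` whose denominator
is a local unit times a power of `f j`, which gives strictness.
-/

noncomputable section

namespace Toric

/-! ### Duality for rational polyhedral cones -/

/-- Farkas' lemma. For a shorter list `t`, a functional `f` separating `x` from the cone of `t` but
negative on `s` is corrected by projecting along `s` to the kernel of `f`. -/
theorem exists_separating_functional {𝕜 V : Type*} [Field 𝕜] [LinearOrder 𝕜]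
    [IsStrictOrderedRing 𝕜] [AddCommGroup V] [Module 𝕜 V] (l : List V) (x : V)
    (hx : x ∉ PointedCone.hull 𝕜 {v | v ∈ l}) :
    ∃ f : V →ₗ[𝕜] 𝕜, (∀ s ∈ l, 0 ≤ f s) ∧ f x < 0 := by
  induction hn : l.length generalizing l x with
  | zero =>
    obtain rfl := List.length_eq_zero_iff.1 hn
    have hx0 : x ≠ 0 := by
      rintro rfl
      exact hx (zero_mem _)
    obtain ⟨f, hf⟩ := Module.Projective.exists_dual_eq_one 𝕜 hx0
    exact ⟨-f, by simp, by simp [hf]⟩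
  | succ n ih =>
    obtain _ | ⟨s, t⟩ := l
    · simp at hn
    have hlen : t.length = n := by simpa using hn
    have hsub : PointedCone.hull 𝕜 {v | v ∈ t} ≤ PointedCone.hull 𝕜 {v | v ∈ s :: t} :=
      Submodule.span_mono fun v hv => List.mem_cons_of_mem _ hv
    have hs : s ∈ PointedCone.hull 𝕜 {v | v ∈ s :: t} :=
      PointedCone.subset_hull (by simp)
    obtain ⟨f, hf, hfx⟩ := ih t x (fun h => hx (hsub h)) hlen
    rcases le_or_gt 0 (f s) with hfs | hfs
    · exact ⟨f, by simpa using ⟨hfs, hf⟩, hfx⟩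
    let π : V →ₗ[𝕜] V := LinearMap.id - (f.smulRight s).comp ((f s)⁻¹ • LinearMap.id)
    have hπ : ∀ v, π v = v - (f v / f s) • s := fun v => by
      simp [π, div_eq_inv_mul]
    have hπt : ∀ v ∈ PointedCone.hull 𝕜 {v | v ∈ t.map π},
        v ∈ PointedCone.hull 𝕜 {v | v ∈ s :: t} := by
      intro v hv
      refine (Submodule.span_le (p := PointedCone.hull 𝕜 {v | v ∈ s :: t})).2 ?_ hv
      intro _ hw'
      obtain ⟨w, hw, rfl⟩ := List.mem_map.1 hw'
      rw [hπ, sub_eq_add_neg, ← neg_smul]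
      refine add_mem (PointedCone.subset_hull (List.mem_cons_of_mem _ hw)) ?_
      exact PointedCone.smul_mem _
        (neg_nonneg.2 (div_nonpos_of_nonneg_of_nonpos (hf w hw) hfs.le)) hs
    obtain ⟨g, hg, hgx⟩ := ih (t.map π) (π x) (fun h => hx (by
      have hx' : x = π x + (f x / f s) • s := by rw [hπ]; abel
      rw [hx']
      exact add_mem (hπt _ h) (PointedCone.smul_mem _ (div_nonneg_of_nonpos hfx.le hfs.le) hs)))
      (by simpa using hlen)
    refine ⟨g.comp π, ?_, hgx⟩
    have hπs : π s = 0 := by rw [hπ, div_self hfs.ne, one_smul, sub_self]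
    intro v hv
    rcases List.mem_cons.1 hv with rfl | hv
    · simp [hπs]
    · exact hg _ (List.mem_map_of_mem hv)

section Cones

variable {N : Type} [AddCommGroup N]

lemma tmul_mem_coneOf {S : Set N} {s : N} (hs : s ∈ S) : (1 : ℚ) ⊗ₜ[ℤ] s ∈ coneOf S :=
  PointedCone.subset_hull ⟨s, hs, rfl⟩

lemma mem_dualMonoid_coneOf {S : Set N} {m : N →ₗ[ℤ] ℤ} :
    m ∈ dualMonoid (coneOf S) ↔ ∀ s ∈ S, 0 ≤ m s := by
  refine ⟨fun h s hs => by simpa using h _ (tmul_mem_coneOf hs), fun h v hv => ?_⟩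
  induction hv using Submodule.span_induction with
  | mem x hx =>
    obtain ⟨s, hs, rfl⟩ := hx
    simpa using h s hs
  | zero => simp
  | add x y _ _ hx hy => rw [map_add]; exact add_nonneg hx hy
  | smul a x _ hx =>
    have : a • x = (a : ℚ) • x := rfl
    rw [this, map_smul]
    exact mul_nonneg a.2 hx

lemma apply_nonneg {σ : PointedCone ℚ (ℚ ⊗[ℤ] N)} {m : N →ₗ[ℤ] ℤ} (hm : m ∈ dualMonoid σ) {v : N}
    (hv : (1 : ℚ) ⊗ₜ[ℤ] v ∈ σ) : 0 ≤ m v := by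
  simpa using hm _ hv

lemma pair_sum {ι : Type*} (s : Finset ι) (m : ι → N →ₗ[ℤ] ℤ) (v : ℚ ⊗[ℤ] N) :
    pair (∑ i ∈ s, m i) v = ∑ i ∈ s, pair (m i) v := by
  classical
  induction s using Finset.induction_on with
  | empty => simp [pair_zero]
  | insert a s ha ih => rw [Finset.sum_insert ha, Finset.sum_insert ha, pair_add, ih]

lemma pair_injective {m : N →ₗ[ℤ] ℤ} (h : pair m = 0) : m = 0 := by
  ext x
  have := LinearMap.congr_fun h ((1 : ℚ) ⊗ₜ[ℤ] x)
  rw [pair_tmul] at this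
  simpa using this

/-- Finitely many nonzero characters are simultaneously nonzero at some lattice point. -/
lemma exists_forall_apply_ne_zero (T : Finset (N →ₗ[ℤ] ℤ)) (hT : ∀ m ∈ T, m ≠ 0) :
    ∃ w : N, ∀ m ∈ T, m w ≠ 0 := by
  classical
  induction T using Finset.induction_on with
  | empty => exact ⟨0, by simp⟩
  | insert m T hm ih =>
    obtain ⟨w, hw⟩ := ih fun m' h => hT m' (Finset.mem_insert_of_mem h)
    obtain ⟨x, hx⟩ : ∃ x, m x ≠ 0 := by
      by_contra! h
      exact hT m (Finset.mem_insert_self _ _) (LinearMap.ext h)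
    -- Each character excludes at most one value of `k` for the point `k w + x`.
    let bad : Finset ℤ := insert (-m x / m w) (T.image fun m' => -m' x / m' w)
    obtain ⟨k, hk⟩ := Infinite.exists_notMem_finset bad
    simp only [bad, Finset.mem_insert, Finset.mem_image, not_or, not_exists, not_and] at hk
    refine ⟨k • w + x, ?_⟩
    have aux : ∀ a b : ℤ, a ≠ 0 → k ≠ -b / a → k * a + b ≠ 0 := by
      intro a b ha hne h0
      refine hne (Int.eq_ediv_of_mul_eq_left ha ?_)
      linarith
    simp only [Finset.mem_insert, forall_eq_or_imp, map_add, map_smul, smul_eq_mul]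
    refine ⟨?_, fun m' hm' => aux _ _ (hw m' hm') fun h => hk.2 m' hm' h.symm⟩
    by_cases h0 : m w = 0
    · simpa [h0] using hx
    · exact aux _ _ h0 hk.1

/-- A cone is full if it spans `N_ℚ`. -/
def IsFull (σ : PointedCone ℚ (ℚ ⊗[ℤ] N)) : Prop :=
  Submodule.span ℚ (σ : Set (ℚ ⊗[ℤ] N)) = ⊤

/-- A full rational polyhedral cone has an interior lattice point. -/
lemma exists_interior_point {σ : PointedCone ℚ (ℚ ⊗[ℤ] N)}
    (hσ : ∃ S : Finset N, σ = coneOf (S : Set N)) (hfull : IsFull σ) :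
    ∃ v : N, (1 : ℚ) ⊗ₜ[ℤ] v ∈ σ ∧ ∀ m ∈ dualMonoid σ, m v = 0 → m = 0 := by
  obtain ⟨S, rfl⟩ := hσ
  refine ⟨∑ s ∈ S, s, ?_, fun m hm h => pair_injective ?_⟩
  · rw [TensorProduct.tmul_sum]
    exact sum_mem fun s hs => tmul_mem_coneOf hs
  · have h1 : ∀ s ∈ S, m s = 0 := by
      rw [map_sum] at h
      exact (Finset.sum_eq_zero_iff_of_nonneg
        fun s hs => apply_nonneg hm (tmul_mem_coneOf hs)).1 h
    refine LinearMap.ext_on hfull fun v hv => ?_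
    induction hv using Submodule.span_induction with
    | mem x hx =>
      obtain ⟨s, hs, rfl⟩ := hx
      simp [h1 s hs]
    | zero => simp
    | add x y _ _ hx hy => rw [map_add, hx, hy, map_add]
    | smul a x _ hx =>
      have : a • x = (a : ℚ) • x := rfl
      rw [this, map_smul, hx, map_smul]

variable [Module.Free ℤ N] [Module.Finite ℤ N]

/-- Every rational functional on `N_ℚ` has a positive multiple that is integral on `N`. -/
lemma exists_pair_eq_mul (f : ℚ ⊗[ℤ] N →ₗ[ℚ] ℚ) :
    ∃ (n : ℕ) (m : N →ₗ[ℤ] ℤ), 0 < n ∧ ∀ v, pair m v = n * f v := by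
  classical
  let b := Module.Free.chooseBasis ℤ N
  let q : Module.Free.ChooseBasisIndex ℤ N → ℚ := fun i => f ((1 : ℚ) ⊗ₜ[ℤ] b i)
  let n : ℕ := ∏ i, (q i).den
  have hn : 0 < n := Finset.prod_pos fun i _ => (q i).pos
  have hint : ∀ i, ∃ z : ℤ, (z : ℚ) = n * q i := by
    intro i
    obtain ⟨c, hc⟩ : (q i).den ∣ n := Finset.dvd_prod_of_mem _ (Finset.mem_univ i)
    refine ⟨c * (q i).num, ?_⟩
    have := (q i).den_ne_zero
    rw [hc]
    push_cast
    nth_rewrite 3 [← Rat.num_div_den (q i)]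
    field_simp
  choose z hz using hint
  refine ⟨n, b.constr ℤ z, hn, fun v => ?_⟩
  have h : pair (b.constr ℤ z) = (n : ℚ) • f := by
    refine (b.baseChange ℚ).ext fun i => ?_
    simp [hz, q]
  rw [h]; rfl

/-- A rational polyhedral cone is the intersection of the half-spaces of its dual monoid. -/
theorem mem_iff_forall_dualMonoid {σ : PointedCone ℚ (ℚ ⊗[ℤ] N)}
    (hσ : ∃ S : Finset N, σ = coneOf (S : Set N)) {v : ℚ ⊗[ℤ] N} :
    v ∈ σ ↔ ∀ m ∈ dualMonoid σ, 0 ≤ pair m v := by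
  refine ⟨fun hv m hm => hm v hv, fun h => ?_⟩
  obtain ⟨S, rfl⟩ := hσ
  by_contra hv
  have hset : {w | w ∈ S.toList.map fun x : N => (1 : ℚ) ⊗ₜ[ℤ] x} =
      (fun x : N => (1 : ℚ) ⊗ₜ[ℤ] x) '' (S : Set N) := by
    ext w; simp
  obtain ⟨f, hf, hfv⟩ := exists_separating_functional (𝕜 := ℚ)
    (S.toList.map fun x : N => (1 : ℚ) ⊗ₜ[ℤ] x) v (by rwa [hset])
  obtain ⟨n, m, hn, hm⟩ := exists_pair_eq_mul f
  have hn' : (0 : ℚ) < n := by exact_mod_cast hn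
  have hmem : m ∈ dualMonoid (coneOf (S : Set N)) := by
    rw [mem_dualMonoid_coneOf]
    intro s hs
    have h1 : (0 : ℚ) ≤ m s := by
      have h2 := hm ((1 : ℚ) ⊗ₜ[ℤ] s)
      rw [pair_tmul, one_mul] at h2
      rw [h2]
      exact mul_nonneg hn'.le (hf _ (List.mem_map.2 ⟨s, by simpa using hs, rfl⟩))
    exact_mod_cast h1
  have h3 := h m hmem
  rw [hm] at h3
  exact absurd h3 (not_le.2 (mul_neg_of_pos_of_neg hn' hfv))

lemma tmul_mem_iff_forall_dualMonoid {σ : PointedCone ℚ (ℚ ⊗[ℤ] N)}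
    (hσ : ∃ S : Finset N, σ = coneOf (S : Set N)) {v : N} :
    (1 : ℚ) ⊗ₜ[ℤ] v ∈ σ ↔ ∀ m ∈ dualMonoid σ, 0 ≤ m v := by
  rw [mem_iff_forall_dualMonoid hσ]
  simp

/-- A strongly convex rational polyhedral cone meets some supporting hyperplane only in `0`. -/
theorem exists_dualMonoid_pos {σ : PointedCone ℚ (ℚ ⊗[ℤ] N)}
    (hσ : ∃ S : Finset N, σ = coneOf (S : Set N)) (hσ' : ∀ v ∈ σ, -v ∈ σ → v = 0) :
    ∃ m ∈ dualMonoid σ, ∀ v ∈ σ, pair m v = 0 → v = 0 := by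
  classical
  have hpol := hσ
  obtain ⟨S, hS⟩ := hσ
  have hpos : ∀ s : N, ∃ m ∈ dualMonoid σ, (1 : ℚ) ⊗ₜ[ℤ] s ∈ σ → (1 : ℚ) ⊗ₜ[ℤ] s ≠ 0 →
      0 < m s := by
    intro s
    by_cases h : (1 : ℚ) ⊗ₜ[ℤ] s ∈ σ ∧ (1 : ℚ) ⊗ₜ[ℤ] s ≠ 0
    · have h1 : -((1 : ℚ) ⊗ₜ[ℤ] s) ∉ σ := fun h2 => h.2 (hσ' _ h.1 h2)
      rw [mem_iff_forall_dualMonoid hpol] at h1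
      push Not at h1
      obtain ⟨m, hm, hlt⟩ := h1
      refine ⟨m, hm, fun _ _ => ?_⟩
      rw [map_neg, pair_tmul, one_mul] at hlt
      have : (0 : ℚ) < m s := by linarith
      exact_mod_cast this
    · exact ⟨0, zero_mem _, fun h1 h2 => absurd ⟨h1, h2⟩ h⟩
  choose m hm hms using hpos
  refine ⟨∑ s ∈ S, m s, sum_mem fun s _ => hm s, fun v hv h0 => ?_⟩
  have hzero : ∀ s ∈ S, pair (m s) v = 0 := by
    rw [pair_sum] at h0
    exact (Finset.sum_eq_zero_iff_of_nonneg fun s _ => hm s v hv).1 h0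
  -- Each nonzero generator `s` has `m s s > 0`, so only combinations of zero generators remain.
  have key : ∀ w ∈ σ, (∀ s ∈ S, pair (m s) w = 0) → w = 0 := by
    intro w hw
    rw [hS] at hw
    induction hw using Submodule.span_induction with
    | mem x hx =>
      obtain ⟨s, hs, rfl⟩ := hx
      intro h
      by_contra hne
      have h1 := hms s (hS ▸ tmul_mem_coneOf hs) hne
      have h2 := h s hs
      simp only [pair_tmul, one_mul] at h2
      have h3 : m s s = 0 := by exact_mod_cast h2
      omega
    | zero => exact fun _ => rfl
    | add x y hx hy ihx ihy =>
      intro h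
      have hx' : x ∈ σ := hS ▸ hx
      have hy' : y ∈ σ := hS ▸ hy
      have h1 : ∀ s ∈ S, pair (m s) x = 0 ∧ pair (m s) y = 0 := by
        intro s hs
        have := h s hs
        rw [map_add] at this
        have h2 := hm s x hx'
        have h3 := hm s y hy'
        exact ⟨by linarith, by linarith⟩
      rw [ihx fun s hs => (h1 s hs).1, ihy fun s hs => (h1 s hs).2, add_zero]
    | smul a x hx ihx =>
      intro h
      have e : a • x = (a : ℚ) • x := rfl
      rcases eq_or_ne (a : ℚ) 0 with ha | ha
      · rw [e, ha, zero_smul]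
      · rw [e, ihx, smul_zero]
        intro s hs
        have := h s hs
        rw [e, map_smul, smul_eq_mul] at this
        exact (mul_eq_zero.1 this).resolve_left ha
  exact key v hv hzero

lemma Fan.bot_mem (F : Fan N) : (⊥ : PointedCone ℚ (ℚ ⊗[ℤ] N)) ∈ F.cones := by
  obtain ⟨σ, hσ⟩ := F.nonempty
  obtain ⟨m, hm, h⟩ := exists_dualMonoid_pos (F.polyhedral σ hσ) (F.stronglyConvex σ hσ)
  refine F.face_mem σ hσ ⊥ ⟨m, hm, fun v => ?_⟩
  rw [Submodule.mem_bot]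
  refine ⟨?_, fun hv => h v hv.1 hv.2⟩
  rintro rfl
  exact ⟨zero_mem _, map_zero _⟩

lemma exists_ne_zero_of_not_isFull {σ : PointedCone ℚ (ℚ ⊗[ℤ] N)} (h : ¬ IsFull σ) :
    ∃ m : N →ₗ[ℤ] ℤ, m ≠ 0 ∧ ∀ v ∈ σ, pair m v = 0 := by
  obtain ⟨f, hf, hle⟩ := Submodule.exists_le_ker_of_lt_top _ (lt_top_iff_ne_top.2 h)
  obtain ⟨n, m, hn, hm⟩ := exists_pair_eq_mul f
  refine ⟨m, ?_, fun v hv => ?_⟩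
  · rintro rfl
    refine hf (LinearMap.ext fun v => ?_)
    have := hm v
    rw [pair_zero, eq_comm, mul_eq_zero] at this
    exact this.resolve_left (by exact_mod_cast hn.ne')
  · rw [hm, LinearMap.mem_ker.1 (hle (Submodule.subset_span hv)), mul_zero]

/-- If the cones of a fan cover `N`, then already its full cones do: for generic `w`, the points
`k v + w` avoid the other cones for all but finitely many `k`, and one full cone contains infinitely
many of them. -/
theorem Fan.exists_isFull_mem (F : Fan N)
    (hF : ∀ v : N, ∃ σ ∈ F.cones, (1 : ℚ) ⊗ₜ[ℤ] v ∈ σ) (v : N) :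
    ∃ σ ∈ F.cones, IsFull σ ∧ (1 : ℚ) ⊗ₜ[ℤ] v ∈ σ := by
  classical
  have hch : ∀ σ : PointedCone ℚ (ℚ ⊗[ℤ] N), ∃ m : N →ₗ[ℤ] ℤ,
      ¬ IsFull σ → m ≠ 0 ∧ ∀ v ∈ σ, pair m v = 0 := by
    intro σ
    by_cases h : IsFull σ
    · exact ⟨0, fun h' => absurd h h'⟩
    · obtain ⟨m, hm⟩ := exists_ne_zero_of_not_isFull h
      exact ⟨m, fun _ => hm⟩
  choose m hm using hch
  obtain ⟨w, hw⟩ := exists_forall_apply_ne_zero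
    ((F.finite.toFinset.filter fun σ => ¬ IsFull σ).image m) (by
      intro m' hm'
      obtain ⟨σ, hσ, rfl⟩ := Finset.mem_image.1 hm'
      exact (hm σ (Finset.mem_filter.1 hσ).2).1)
  choose c hc hcv using fun k : ℕ => hF (k • v + w)
  have : Finite F.cones := F.finite
  obtain ⟨σ, hσinf⟩ := Finite.exists_infinite_fiber (fun k : ℕ => (⟨c k, hc k⟩ : F.cones))
  have hinf : {k : ℕ | c k = σ.1}.Infinite := by
    rw [← Set.infinite_coe_iff]
    convert hσinf using 2
    ext k
    simp [Subtype.ext_iff]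
  have hmem : ∀ k : ℕ, c k = σ.1 → (1 : ℚ) ⊗ₜ[ℤ] (k • v + w) ∈ σ.1 := fun k hk => hk ▸ hcv k
  refine ⟨σ.1, σ.2, ?_, ?_⟩
  · by_contra hfull
    obtain ⟨k, hk⟩ := hinf.nonempty
    obtain ⟨l, hl, hkl⟩ := hinf.exists_gt k
    have hzero : ∀ j : ℕ, c j = σ.1 → j * m σ.1 v + m σ.1 w = 0 := by
      intro j hj
      have := (hm σ.1 hfull).2 _ (hmem j hj)
      rw [pair_tmul, one_mul] at this
      have h2 : m σ.1 (j • v + w) = 0 := by exact_mod_cast this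
      simpa using h2
    have h1 := hzero k hk
    have h2 := hzero l hl
    have h3 : ((l : ℤ) - k) * m σ.1 v = 0 := by linear_combination h2 - h1
    have h4 : m σ.1 v = 0 := by
      refine (mul_eq_zero.1 h3).resolve_left ?_
      have : (k : ℤ) < l := by exact_mod_cast hkl
      omega
    refine hw (m σ.1) (Finset.mem_image_of_mem _ ?_) (by simpa [h4] using h1)
    simpa using And.intro σ.2 hfull
  · rw [tmul_mem_iff_forall_dualMonoid (F.polyhedral _ σ.2)]
    intro u hu
    by_contra! hneg
    obtain ⟨k, hk, hkl⟩ := hinf.exists_gt (u w).natAbs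
    have h1 := apply_nonneg hu (hmem k hk)
    simp only [map_add, map_nsmul, nsmul_eq_mul] at h1
    have h2 : u w ≤ (u w).natAbs := by omega
    have h3 : ((u w).natAbs : ℤ) < k := by exact_mod_cast hkl
    nlinarith

end Cones

/-! ### Supports of Laurent polynomials -/

section Laurent

variable {M : Type*} [AddCommGroup M]

/-- A product of Laurent polynomials contains, for every weight `w`, the sum of two suitable
exponents of minimal weight: among the exponents of minimal weight of the two factors there is a
pair whose sum is attained only once. -/
theorem exists_minimal_add_mem_support [UniqueSums M] {k : Type*} [Semiring k] [NoZeroDivisors k]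
    (w : M →+ ℤ) {f g : AddMonoidAlgebra k M} (hf : f ≠ 0) (hg : g ≠ 0) :
    ∃ m ∈ f.coeff.support, ∃ m' ∈ g.coeff.support, m + m' ∈ (f * g).coeff.support ∧
      (∀ x ∈ f.coeff.support, w m ≤ w x) ∧ ∀ x ∈ g.coeff.support, w m' ≤ w x := by
  classical
  have hmin : ∀ h : AddMonoidAlgebra k M, h ≠ 0 →
      ∃ m ∈ h.coeff.support, ∀ x ∈ h.coeff.support, w m ≤ w x := fun h hh =>
    Finset.exists_min_image _ w (Finsupp.support_nonempty_iff.2 (by simpa using hh))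
  obtain ⟨a, ha, hamin⟩ := hmin f hf
  obtain ⟨b, hb, hbmin⟩ := hmin g hg
  obtain ⟨m, hm, m', hm', huniq⟩ := UniqueSums.uniqueAdd_of_nonempty
    (A := f.coeff.support.filter fun x => w x = w a)
    (B := g.coeff.support.filter fun x => w x = w b)
    ⟨a, by simpa using ha⟩ ⟨b, by simpa using hb⟩
  rw [Finset.mem_filter] at hm hm'
  have huniq' : UniqueAdd f.coeff.support g.coeff.support m m' := by
    intro x y hx hy hxy
    have h1 := hamin x hx
    have h2 := hbmin y hy
    have h3 : w x + w y = w m + w m' := by rw [← map_add, hxy, map_add]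
    refine huniq (Finset.mem_filter.2 ⟨hx, ?_⟩) (Finset.mem_filter.2 ⟨hy, ?_⟩) hxy <;>
      linarith [hm.2, hm'.2]
  refine ⟨m, hm.1, m', hm'.1, ?_, fun x hx => hm.2 ▸ hamin x hx, fun x hx => hm'.2 ▸ hbmin x hx⟩
  rw [Finsupp.mem_support_iff, AddMonoidAlgebra.coeff_mul_add_of_uniqueAdd huniq']
  exact mul_ne_zero (Finsupp.mem_support_iff.1 hm.1) (Finsupp.mem_support_iff.1 hm'.1)

/-- Powers of a Laurent polynomial attain `d` times the minimal weight. -/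
lemma exists_mem_support_pow [UniqueSums M] {k : Type*} [Semiring k] [NoZeroDivisors k]
    [Nontrivial k] (w : M →+ ℤ) {f : AddMonoidAlgebra k M} {c : ℤ}
    (hc : ∃ m ∈ f.coeff.support, w m ≤ c) (d : ℕ) :
    ∃ m ∈ (f ^ d).coeff.support, w m ≤ d * c := by
  have hf : f ≠ 0 := by
    rintro rfl
    simp at hc
  obtain ⟨m₀, hm₀, hm₀c⟩ := hc
  induction d with
  | zero => exact ⟨0, by simp [AddMonoidAlgebra.one_def], by simp⟩
  | succ d ih =>
    obtain ⟨m, hm, hmc⟩ := ih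
    have hfd : f ^ d ≠ 0 := by
      intro h
      simp [h] at hm
    obtain ⟨x, -, y, -, hxy, hx, hy⟩ := exists_minimal_add_mem_support w hfd hf
    refine ⟨x + y, by rwa [pow_succ], ?_⟩
    have h1 := hx m hm
    have h2 := hy m₀ hm₀
    rw [map_add]
    push_cast
    linarith

/-- All exponents of `f` are sums of `d` elements of `S`. -/
def SupportedInSums {k : Type*} [Semiring k] (S : Set M) (d : ℕ) (f : AddMonoidAlgebra k M) :
    Prop :=
  ∀ y ∈ f.coeff.support, ∃ T : Multiset M, T.card = d ∧ (∀ t ∈ T, t ∈ S) ∧ T.sum = y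

namespace SupportedInSums

variable {k : Type*} [Semiring k] {S : Set M} {d e : ℕ} {f g : AddMonoidAlgebra k M}

lemma one : SupportedInSums S 0 (1 : AddMonoidAlgebra k M) := by
  intro y hy
  have : y = 0 := by
    by_contra h
    rw [AddMonoidAlgebra.one_def, Finsupp.mem_support_iff] at hy
    exact hy (Finsupp.single_eq_of_ne h)
  exact ⟨0, by simp [this]⟩

lemma mul (hf : SupportedInSums S d f) (hg : SupportedInSums S e g) :
    SupportedInSums S (d + e) (f * g) := by
  classical
  intro y hy
  obtain ⟨a, ha, b, hb, rfl⟩ :=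
    Finset.mem_add.1 (AddMonoidAlgebra.support_coeff_mul_subset f g hy)
  obtain ⟨T, rfl, hT, rfl⟩ := hf a ha
  obtain ⟨U, rfl, hU, rfl⟩ := hg b hb
  refine ⟨T + U, by simp, fun t ht => ?_, by simp⟩
  exact (Multiset.mem_add.1 ht).elim (hT t) (hU t)

lemma pow (hf : SupportedInSums S 1 f) (n : ℕ) : SupportedInSums S n (f ^ n) := by
  induction n with
  | zero => simpa using one
  | succ n ih => rw [pow_succ]; exact ih.mul hf

lemma zero : SupportedInSums S d (0 : AddMonoidAlgebra k M) := by
  intro y hy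
  simp at hy

lemma add (hf : SupportedInSums S d f) (hg : SupportedInSums S d g) :
    SupportedInSums S d (f + g) := by
  classical
  intro y hy
  exact (Finset.mem_union.1 (Finsupp.support_add hy)).elim (hf y) (hg y)

lemma smul (c : k) (hf : SupportedInSums S d f) : SupportedInSums S d (c • f) := fun y hy =>
  hf y (Finsupp.support_smul hy)

end SupportedInSums

/-- A form of degree `d` in Laurent polynomials with exponents in `S` only involves sums of `d`
elements of `S`. -/
lemma supportedInSums_aeval {k : Type*} [CommSemiring k] {ι : Type*} [Fintype ι]
    (f : ι → AddMonoidAlgebra k M) {S : Set M} (hS : ∀ i, ∀ m ∈ (f i).coeff.support, m ∈ S)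
    {G : MvPolynomial ι k} {d : ℕ} (hG : G.IsHomogeneous d) :
    SupportedInSums S d (MvPolynomial.aeval f G) := by
  classical
  rw [MvPolynomial.aeval_def, MvPolynomial.eval₂_eq']
  simp only [← Algebra.smul_def]
  have hsum : ∀ (A : Finset (ι →₀ ℕ)) (h : (ι →₀ ℕ) → AddMonoidAlgebra k M),
      (∀ a ∈ A, SupportedInSums S d (h a)) → SupportedInSums S d (∑ a ∈ A, h a) := fun A h hA =>
    Finset.sum_induction h (SupportedInSums S d) (fun _ _ => SupportedInSums.add) .zero hA
  refine hsum _ _ fun a ha => SupportedInSums.smul _ ?_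
  have hd : ∑ i, a i = d := by
    have := hG (MvPolynomial.mem_support_iff.1 ha)
    rw [← this, Finsupp.weight_apply, Finsupp.sum_fintype _ _ (by simp)]
    simp
  rw [← hd]
  generalize (Finset.univ : Finset ι) = A
  induction A using Finset.induction_on with
  | empty => simpa using SupportedInSums.one
  | insert i A hi ih =>
    rw [Finset.prod_insert hi, Finset.sum_insert hi]
    refine SupportedInSums.mul (SupportedInSums.pow (fun y hy => ⟨{y}, ?_⟩) _) ih
    simpa using hS i y (by simpa using hy)

/-- A ring of Laurent polynomials is factorial, being a localization of a polynomial ring. -/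
theorem uniqueFactorizationMonoid_addMonoidAlgebra (k : Type*) [Field k] [Module.Free ℤ M]
    [Module.Finite ℤ M] : UniqueFactorizationMonoid (AddMonoidAlgebra k M) := by
  classical
  let b := Module.Free.chooseBasis ℤ M
  let P := Module.Free.ChooseBasisIndex ℤ M →₀ ℕ
  let j : P →+ M :=
    (b.repr.symm : _ →+ M).comp (Finsupp.mapRange.addMonoidHom (Nat.castAddMonoidHom ℤ))
  have hj : Function.Injective j := b.repr.symm.injective.comp
    (Finsupp.mapRange_injective _ (by simp) Nat.cast_injective)
  -- `j` identifies the exponents of polynomials with the elements of nonnegative coordinates.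
  have hjr : ∀ m : M, (∀ i, 0 ≤ b.repr m i) → ∃ p, j p = m := by
    intro m hm
    refine ⟨(b.repr m).mapRange Int.toNat (by simp), b.repr.injective ?_⟩
    ext i
    simp only [j, AddMonoidHom.comp_apply]
    exact (DFunLike.congr_fun (b.repr.apply_symm_apply _) i).trans (Int.toNat_of_nonneg (hm i))
  have hshift : ∀ m : M, ∃ q p, m + j q = j p := by
    intro m
    obtain ⟨q, hq⟩ := hjr (b.repr.symm ((b.repr m).mapRange (fun z => |z|) (by simp))) (by simp)
    obtain ⟨p, hp⟩ := hjr (m + j q) (by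
      intro i
      have := neg_abs_le (b.repr m i)
      simp [hq]
      linarith)
    exact ⟨q, p, hp.symm⟩
  let φ : AddMonoidAlgebra k P →+* AddMonoidAlgebra k M := AddMonoidAlgebra.mapDomainRingHom k j
  have hφs : ∀ p c, φ (AddMonoidAlgebra.single p c) = AddMonoidAlgebra.single (j p) c := by
    simp [φ]
  have hφ : Function.Injective φ := AddMonoidAlgebra.mapDomain_injective hj
  let := φ.toAlgebra
  let S : Submonoid (AddMonoidAlgebra k P) := MonoidHom.mrange (AddMonoidAlgebra.of k P)
  have : IsLocalization S (AddMonoidAlgebra k M) := by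
    refine ⟨?_, ?_, fun {x y} h => ⟨1, by rw [hφ h]⟩⟩
    · rintro ⟨_, p, rfl⟩
      refine IsUnit.of_mul_eq_one (AddMonoidAlgebra.single (-j p.toAdd) 1) ?_
      change φ (AddMonoidAlgebra.single _ 1) * _ = 1
      rw [hφs, AddMonoidAlgebra.single_mul_single, add_neg_cancel, mul_one]
      rfl
    · intro z
      suffices h : ∃ (q : P) (x : AddMonoidAlgebra k P),
          z * AddMonoidAlgebra.single (j q) 1 = φ x by
        obtain ⟨q, x, h⟩ := h
        refine ⟨(x, ⟨AddMonoidAlgebra.single q 1, Multiplicative.ofAdd q, rfl⟩), ?_⟩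
        change z * φ (AddMonoidAlgebra.single q 1) = φ x
        rw [hφs, h]
      induction z using AddMonoidAlgebra.induction_linear with
      | zero => exact ⟨0, 0, by simp⟩
      | add x y hx hy =>
        obtain ⟨q, x', hx⟩ := hx
        obtain ⟨q', y', hy⟩ := hy
        refine ⟨q + q', x' * AddMonoidAlgebra.single q' 1 + y' * AddMonoidAlgebra.single q 1, ?_⟩
        have h1 : (AddMonoidAlgebra.single (j (q + q')) 1 : AddMonoidAlgebra k M) =
            AddMonoidAlgebra.single (j q) 1 * AddMonoidAlgebra.single (j q') 1 := by
          rw [AddMonoidAlgebra.single_mul_single, map_add, mul_one]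
        rw [h1, map_add φ, map_mul, map_mul, hφs, hφs, ← hx, ← hy]
        ring
      | single m c =>
        obtain ⟨q, p, h⟩ := hshift m
        exact ⟨q, AddMonoidAlgebra.single p c, by
          rw [hφs, AddMonoidAlgebra.single_mul_single, h, mul_one]⟩
  have : UniqueFactorizationMonoid (AddMonoidAlgebra k P) :=
    inferInstanceAs (UniqueFactorizationMonoid (MvPolynomial _ k))
  exact UniqueFactorizationMonoid.of_isLocalization S (AddMonoidAlgebra k M)

/-- A free module of finite rank over `ℤ` has the unique sums property. -/
theorem twoUniqueSums_of_free [Module.Free ℤ M] [Module.Finite ℤ M] : TwoUniqueSums M :=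
  (Module.Free.chooseBasis ℤ M).repr.toAddEquiv.twoUniqueSums_iff.2 inferInstance

end Laurent

/-! ### Local coordinates on projective space -/

section Coordinates

attribute [local instance] MvPolynomial.gradedAlgebra

variable {ι : Type*} {K : Type*} [Field K] [Algebra ℂ K]

/-- Rescaling the variables of a form of degree `d` by `u` multiplies it by `u ^ d`. -/
lemma eval₂_mul_of_isHomogeneous {k A : Type*} [CommSemiring k] [CommSemiring A] [Finite ι]
    (φ : k →+* A) (x : ι → A) (u : A) {H : MvPolynomial ι k} {d : ℕ} (hH : H.IsHomogeneous d) :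
    MvPolynomial.eval₂ φ (fun i => u * x i) H = u ^ d * MvPolynomial.eval₂ φ x H := by
  classical
  have := Fintype.ofFinite ι
  rw [MvPolynomial.eval₂_eq', MvPolynomial.eval₂_eq', Finset.mul_sum]
  refine Finset.sum_congr rfl fun a ha => ?_
  have hd : ∑ i, a i = d := by
    have := hH (MvPolynomial.mem_support_iff.1 ha)
    rw [← this, Finsupp.weight_apply, Finsupp.sum_fintype _ _ (by simp)]
    simp
  simp only [mul_pow, Finset.prod_mul_distrib, Finset.prod_pow_eq_pow_sum, hd]
  ring

variable {𝔮 : Ideal (MvPolynomial ι ℂ)} [𝔮.IsPrime]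

/-- The fraction `H / G` of two forms of degree `d` in the homogeneous localization. -/
def formFraction {d : ℕ} {H G : MvPolynomial ι ℂ}
    (hH : H ∈ MvPolynomial.homogeneousSubmodule ι ℂ d)
    (hG : G ∈ MvPolynomial.homogeneousSubmodule ι ℂ d) (hG' : G ∉ 𝔮) :
    HomogeneousLocalization.AtPrime (MvPolynomial.homogeneousSubmodule ι ℂ) 𝔮 :=
  HomogeneousLocalization.mk ⟨d, ⟨H, hH⟩, ⟨G, hG⟩, hG'⟩

lemma X_mem (k : ι) : (MvPolynomial.X k : MvPolynomial ι ℂ) ∈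
    MvPolynomial.homogeneousSubmodule ι ℂ 1 := MvPolynomial.isHomogeneous_X ℂ k

lemma X_pow_mem (k : ι) (d : ℕ) : (MvPolynomial.X k ^ d : MvPolynomial ι ℂ) ∈
    MvPolynomial.homogeneousSubmodule ι ℂ d := MvPolynomial.isHomogeneous_X_pow k d

lemma X_pow_notMem {k : ι} (hk : MvPolynomial.X k ∉ 𝔮) (d : ℕ) :
    (MvPolynomial.X k ^ d : MvPolynomial ι ℂ) ∉ 𝔮 := fun h =>
  hk (Ideal.IsPrime.mem_of_pow_mem inferInstance d h)

variable (θ : HomogeneousLocalization.AtPrime (MvPolynomial.homogeneousSubmodule ι ℂ) 𝔮 →+* K)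
  (hθ : ∀ c, θ (HomogeneousLocalization.fromZeroRingHom (MvPolynomial.homogeneousSubmodule ι ℂ) _
    (algebraMap ℂ _ c)) = algebraMap ℂ K c)
  {k₀ : ι} (hk₀ : MvPolynomial.X k₀ ∉ 𝔮)

include hθ in
/-- A ring homomorphism over `ℂ` on the fractions of forms is determined by the values of the
coordinates `X k / X k₀`: dehomogenization. -/
lemma map_formFraction_X_pow [Finite ι] {d : ℕ} {H : MvPolynomial ι ℂ}
    (hH : H ∈ MvPolynomial.homogeneousSubmodule ι ℂ d) :
    θ (formFraction hH (X_pow_mem k₀ d) (X_pow_notMem hk₀ d)) =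
      MvPolynomial.aeval (fun k => θ (formFraction (X_mem k) (X_mem k₀) hk₀)) H := by
  let κ := (HomogeneousLocalization.fromZeroRingHom (MvPolynomial.homogeneousSubmodule ι ℂ)
    𝔮.primeCompl).comp (algebraMap ℂ _)
  have key : formFraction hH (X_pow_mem k₀ d) (X_pow_notMem hk₀ d) =
      MvPolynomial.eval₂ κ (fun k => formFraction (X_mem k) (X_mem k₀) hk₀) H := by
    apply HomogeneousLocalization.val_injective
    rw [← HomogeneousLocalization.algebraMap_apply, ← HomogeneousLocalization.algebraMap_apply,
      MvPolynomial.hom_eval₂]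
    let L := Localization.AtPrime 𝔮
    let φ : ℂ →+* L := (algebraMap (MvPolynomial ι ℂ) L).comp MvPolynomial.C
    let u : L := Localization.mk 1 ⟨MvPolynomial.X k₀, hk₀⟩
    have hu : ∀ P : MvPolynomial ι ℂ, ∀ n : ℕ, u ^ n * algebraMap _ L P =
        Localization.mk P ⟨MvPolynomial.X k₀ ^ n, X_pow_notMem hk₀ n⟩ := fun P n => by
      rw [← Localization.mk_one_eq_algebraMap, Localization.mk_pow, Localization.mk_mul]
      simp only [one_pow, one_mul, mul_one]
      rfl
    have h1 := eval₂_mul_of_isHomogeneous φ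
      (fun i => algebraMap (MvPolynomial ι ℂ) L (MvPolynomial.X i)) u hH
    have h2 : MvPolynomial.eval₂ φ (fun i => algebraMap (MvPolynomial ι ℂ) L (MvPolynomial.X i)) H =
        algebraMap _ L H := by
      rw [← MvPolynomial.hom_eval₂ H MvPolynomial.C, MvPolynomial.eval₂_eta]
    rw [h2, hu] at h1
    refine h1.symm.trans ?_
    congr 1
    funext i
    have := hu (MvPolynomial.X i) 1
    rw [pow_one] at this
    rw [this]
    simp [formFraction]
  rw [key, MvPolynomial.hom_eval₂, MvPolynomial.aeval_def]
  congr 1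
  ext c
  exact hθ c

include hθ in
lemma map_formFraction_mul [Finite ι] {d : ℕ} {H G : MvPolynomial ι ℂ}
    (hH : H ∈ MvPolynomial.homogeneousSubmodule ι ℂ d)
    (hG : G ∈ MvPolynomial.homogeneousSubmodule ι ℂ d) (hG' : G ∉ 𝔮) :
    θ (formFraction hH hG hG') *
        MvPolynomial.aeval (fun k => θ (formFraction (X_mem k) (X_mem k₀) hk₀)) G =
      MvPolynomial.aeval (fun k => θ (formFraction (X_mem k) (X_mem k₀) hk₀)) H := by
  rw [← map_formFraction_X_pow θ hθ hk₀ hG, ← map_formFraction_X_pow θ hθ hk₀ hH, ← map_mul]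
  congr 1
  apply HomogeneousLocalization.val_injective
  simp only [formFraction, HomogeneousLocalization.val_mul, HomogeneousLocalization.val_mk,
    Localization.mk_mul]
  rw [Localization.mk_eq_mk_iff, Localization.r_iff_exists]
  exact ⟨1, by simp; ring⟩

end Coordinates

section Stalks

universe u
variable {σ A : Type u} [CommRing A] [SetLike σ A] [AddSubgroupClass σ A] (𝒜 : ℕ → σ) [GradedRing 𝒜]

lemma fromSpecStalk_toSpecZero (z : Proj 𝒜) :
    (Proj 𝒜).fromSpecStalk z ≫ Proj.toSpecZero 𝒜 = Spec.map (CommRingCat.ofHom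
      (HomogeneousLocalization.fromZeroRingHom 𝒜 _) ≫ (Proj.stalkIso 𝒜 z).inv) := by
  have hz : z ∈ Proj.basicOpen 𝒜 (1 : A) := by rw [Proj.basicOpen_one]; trivial
  have key (U : (Proj 𝒜).Opens) (e : U = ⊤) (hz : z ∈ U) :
      (Proj 𝒜).fromSpecStalk z ≫ (Scheme.topIso _).inv ≫ (Scheme.isoOfEq _ e).inv =
        U.fromSpecStalkOfMem z hz := by
    rw [← cancel_mono U.ι]
    simp [Scheme.isoOfEq_inv]
  rw [Proj.toSpecZero, reassoc_of% key _ _ hz, Proj.basicOpenToSpec, Category.assoc,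
    Scheme.Opens.fromSpecStalkOfMem_toSpecΓ_assoc, ← Spec.map_comp, ← Spec.map_comp]
  congr 1

lemma toIdeal_le_of_specializes {y z : Proj 𝒜} (h : z ⤳ y) :
    z.asHomogeneousIdeal.toIdeal ≤ y.asHomogeneousIdeal.toIdeal :=
  (ProjectiveSpectrum.le_iff_mem_closure 𝒜 z y).2 h.mem_closure

lemma stalkSpecializes_stalkIso_inv {y z : Proj 𝒜} (h : z ⤳ y) (d : ℕ) (H G : 𝒜 d)
    (hy : (G : A) ∉ y.asHomogeneousIdeal.toIdeal) (hz : (G : A) ∉ z.asHomogeneousIdeal.toIdeal) :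
    (Proj 𝒜).presheaf.stalkSpecializes h
      ((Proj.stalkIso 𝒜 y).inv (HomogeneousLocalization.mk ⟨d, H, G, hy⟩)) =
      (Proj.stalkIso 𝒜 z).inv (HomogeneousLocalization.mk ⟨d, H, G, hz⟩) := by
  exact TopCat.Presheaf.germ_stalkSpecializes_apply _ _ _ _

end Stalks

section Embedding

attribute [local instance] MvPolynomial.gradedAlgebra

instance {ι : Type*} (z : Proj (MvPolynomial.homogeneousSubmodule ι ℂ)) :
    z.asHomogeneousIdeal.toIdeal.IsPrime := ProjectiveSpectrum.isPrime z

lemma exists_X_notMem {ι : Type*} (z : Proj (MvPolynomial.homogeneousSubmodule ι ℂ)) :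
    ∃ j, MvPolynomial.X j ∉ z.asHomogeneousIdeal.toIdeal := by
  by_contra! hall
  refine ProjectiveSpectrum.not_irrelevant_le z fun P hP => ?_
  have hspan : Ideal.span (MvPolynomial.X '' (Set.univ : Set ι)) ≤
      z.asHomogeneousIdeal.toIdeal := by
    rw [Ideal.span_le]
    rintro _ ⟨j, -, rfl⟩
    exact hall j
  refine hspan (MvPolynomial.mem_ideal_span_X_image.2 fun m hm => ?_)
  have hP' : MvPolynomial.homogeneousComponent 0 P = 0 :=
    (MvPolynomial.decomposition.decompose'_apply P 0).symm.trans
      ((HomogeneousIdeal.mem_irrelevant_iff _ P).1 hP)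
  rw [MvPolynomial.homogeneousComponent_zero, MvPolynomial.C_eq_zero] at hP'
  by_contra! hm0
  have : m = 0 := Finsupp.ext fun i => hm0 i (Set.mem_univ i)
  rw [this] at hm
  exact MvPolynomial.mem_support_iff.1 hm hP'

variable {ι : Type} {K : Type} [Field K] [Algebra ℂ K]
  (f : Spec (CommRingCat.of K) ⟶ Proj (MvPolynomial.homogeneousSubmodule ι ℂ))

/-- The evaluation of fractions of forms at a `K`-valued point of projective space. -/
def pointEval : HomogeneousLocalization.AtPrime (MvPolynomial.homogeneousSubmodule ι ℂ)
    (f (IsLocalRing.closedPoint K)).asHomogeneousIdeal.toIdeal →+* K :=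
  ((Proj.stalkIso (MvPolynomial.homogeneousSubmodule ι ℂ) _).inv ≫
    Scheme.stalkClosedPointTo f).hom

lemma pointEval_fromZeroRingHom
    (hf : f ≫ Proj.toSpecZero (MvPolynomial.homogeneousSubmodule ι ℂ) ≫
      Spec.map (CommRingCat.ofHom (algebraMap ℂ (MvPolynomial.homogeneousSubmodule ι ℂ 0))) =
      Spec.map (CommRingCat.ofHom (algebraMap ℂ K))) (c : ℂ) :
    pointEval f (HomogeneousLocalization.fromZeroRingHom _ _ (algebraMap ℂ _ c)) =
      algebraMap ℂ K c := by
  have h := Scheme.Spec_stalkClosedPointTo_fromSpecStalk f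
  have h2 := fromSpecStalk_toSpecZero (MvPolynomial.homogeneousSubmodule ι ℂ)
    (f (IsLocalRing.closedPoint K))
  rw [← h, Category.assoc, ← Category.assoc (Scheme.fromSpecStalk _ _), h2, ← Spec.map_comp,
    ← Spec.map_comp] at hf
  have := Spec.map_injective hf
  exact congr($(this) c)

/-- The coordinates of a `K`-valued point of projective space, normalized by `g k₀ = 1` for a
coordinate `k₀` that does not vanish. -/
def pointCoord {k₀ : ι}
    (hk₀ : MvPolynomial.X k₀ ∉ (f (IsLocalRing.closedPoint K)).asHomogeneousIdeal.toIdeal)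
    (k : ι) : K :=
  pointEval f (formFraction (X_mem k) (X_mem k₀) hk₀)

omit [Algebra ℂ K] in
/-- The map `γ` from the local ring of `Spec A` at `p` to a field `K` containing `A`: its values are
fractions whose denominators lie outside `p`, and so do the numerators in the case of units. -/
lemma exists_stalk_ringHom {A : Type} [CommRing A] [Algebra A K]
    (hA : Function.Injective (algebraMap A K)) (p : Spec (CommRingCat.of A)) :
    ∃ (ρ : CommRingCat.of A ⟶ (Spec (CommRingCat.of A)).presheaf.stalk p)
      (γ : (Spec (CommRingCat.of A)).presheaf.stalk p ⟶ CommRingCat.of K),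
      Spec.map ρ = (Spec (CommRingCat.of A)).fromSpecStalk p ∧
      ρ ≫ γ = CommRingCat.ofHom (algebraMap A K) ∧
      ∀ t, ∃ a b : A, b ∉ p.asIdeal ∧ (IsUnit t → a ∉ p.asIdeal) ∧
        γ t * algebraMap A K b = algebraMap A K a := by
  let p' : PrimeSpectrum A := p
  have hloc := StructureSheaf.IsLocalization.to_stalk A p'
  have hunit : ∀ a : p'.asIdeal.primeCompl, IsUnit (algebraMap A K a) := fun a => by
    refine ((map_ne_zero_iff _ hA).2 fun h => a.2 ?_).isUnit
    rw [h]
    exact zero_mem _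
  let γ' := IsLocalization.lift (S := (Spec.structureSheaf A).presheaf.stalk p') hunit
  have hγ' : ∀ a, γ' (StructureSheaf.toStalk A p' a) = algebraMap A K a :=
    IsLocalization.lift_eq (S := (Spec.structureSheaf A).presheaf.stalk p') hunit
  refine ⟨StructureSheaf.toStalk A p', CommRingCat.ofHom γ',
    (Spec.fromSpecStalk_eq' (CommRingCat.of A) p).symm, by ext a; exact hγ' a, fun t => ?_⟩
  obtain ⟨⟨a, b⟩, h⟩ := IsLocalization.surj
    (S := (Spec.structureSheaf A).presheaf.stalk p') p'.asIdeal.primeCompl t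
  have hu : ∀ b : A, IsUnit (StructureSheaf.toStalk A p' b) ↔ b ∉ p'.asIdeal :=
    IsLocalization.AtPrime.isUnit_to_map_iff
      ((Spec.structureSheaf A).presheaf.stalk p') p'.asIdeal
  refine ⟨a, b, b.2, fun ht => ?_, ?_⟩
  · exact (hu a).1 (h ▸ ht.mul ((hu b).2 b.2))
  · exact (congrArg _ (hγ' b)).symm.trans
      (((map_mul γ' t _).symm.trans (congrArg γ' h)).trans (hγ' a))

/-- Let `h` be a map from `Spec A` to projective space that is surjective on stalks, with `A` inside
a field `K`, and let `p ∈ Spec A`. Some coordinate `g j` of the resulting `K`-valued point does not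
vanish at `p`, so that the ratios `g k / g j` lie in the local ring at `p`; and each `u ∈ A` is a
ratio `H(g) / G(g)` of forms of the same degree `d` with `G(g)` a unit multiple of `g j ^ d` in this
local ring. -/
theorem pointCoord_chart [Finite ι]
    (hf : f ≫ Proj.toSpecZero (MvPolynomial.homogeneousSubmodule ι ℂ) ≫
      Spec.map (CommRingCat.ofHom (algebraMap ℂ (MvPolynomial.homogeneousSubmodule ι ℂ 0))) =
      Spec.map (CommRingCat.ofHom (algebraMap ℂ K))) {k₀ : ι}
    (hk₀ : MvPolynomial.X k₀ ∉ (f (IsLocalRing.closedPoint K)).asHomogeneousIdeal.toIdeal)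
    {A : Type} [CommRing A] [Algebra A K] (hA : Function.Injective (algebraMap A K))
    (h : Spec (CommRingCat.of A) ⟶ Proj (MvPolynomial.homogeneousSubmodule ι ℂ))
    [SurjectiveOnStalks h] (hh : Spec.map (CommRingCat.ofHom (algebraMap A K)) ≫ h = f)
    (p : PrimeSpectrum A) :
    ∃ j, (∀ k, ∃ a b : A, b ∉ p.asIdeal ∧
        algebraMap A K b * pointCoord f hk₀ k = algebraMap A K a * pointCoord f hk₀ j) ∧
      ∀ u : A, ∃ (d : ℕ) (G H : MvPolynomial ι ℂ), G.IsHomogeneous d ∧ H.IsHomogeneous d ∧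
        algebraMap A K u * MvPolynomial.aeval (pointCoord f hk₀) G =
          MvPolynomial.aeval (pointCoord f hk₀) H ∧
        ∃ a b : A, a ∉ p.asIdeal ∧ b ∉ p.asIdeal ∧
          algebraMap A K b * MvPolynomial.aeval (pointCoord f hk₀) G =
            algebraMap A K a * pointCoord f hk₀ j ^ d := by
  let x : Spec (CommRingCat.of A) := p
  let y := h x
  let z := f (IsLocalRing.closedPoint K)
  obtain ⟨ρ, γ, hρ, hργ, hfrac⟩ := exists_stalk_ringHom hA x
  have hzy : z ⤳ y := by
    have h1 : (Spec.map (CommRingCat.ofHom (algebraMap A K)) (IsLocalRing.closedPoint K)) ⤳ x := by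
      refine (PrimeSpectrum.le_iff_specializes _ _).1 ?_
      intro a ha
      have ha' : ¬ IsUnit (algebraMap A K a) := (IsLocalRing.mem_maximalIdeal _).1 ha
      rw [isUnit_iff_ne_zero, not_not, map_eq_zero_iff _ hA] at ha'
      rw [ha']
      exact zero_mem _
    have h2 : z =
        h (Spec.map (CommRingCat.ofHom (algebraMap A K)) (IsLocalRing.closedPoint K)) := by
      simp only [z, ← hh]
      rfl
    rw [h2]
    exact h1.map h.continuous
  have key : (Proj (MvPolynomial.homogeneousSubmodule ι ℂ)).presheaf.stalkSpecializes hzy ≫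
      Scheme.stalkClosedPointTo f = h.stalkMap x ≫ γ := by
    apply Spec.map_injective
    rw [← cancel_mono ((Proj (MvPolynomial.homogeneousSubmodule ι ℂ)).fromSpecStalk y)]
    rw [Spec.map_comp, Spec.map_comp, Category.assoc, Category.assoc,
      Scheme.SpecMap_stalkSpecializes_fromSpecStalk, Scheme.Spec_stalkClosedPointTo_fromSpecStalk,
      Scheme.SpecMap_stalkMap_fromSpecStalk, ← hρ, ← Spec.map_comp_assoc, hργ, hh]
  -- Fractions that are defined at the image of `p` evaluate to elements of the local ring at `p`.
  have eval : ∀ {d : ℕ} {H G : MvPolynomial ι ℂ}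
      (hH : H ∈ MvPolynomial.homogeneousSubmodule ι ℂ d)
      (hG : G ∈ MvPolynomial.homogeneousSubmodule ι ℂ d) (hy : G ∉ y.asHomogeneousIdeal.toIdeal),
      γ (h.stalkMap x ((Proj.stalkIso (MvPolynomial.homogeneousSubmodule ι ℂ) y).inv
        (formFraction hH hG hy))) * MvPolynomial.aeval (pointCoord f hk₀) G =
      MvPolynomial.aeval (pointCoord f hk₀) H := by
    intro d H G hH hG hy
    have hz : G ∉ z.asHomogeneousIdeal.toIdeal := fun hG' =>
      hy (toIdeal_le_of_specializes _ hzy hG')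
    refine Eq.trans ?_ (map_formFraction_mul (pointEval f) (pointEval_fromZeroRingHom f hf) hk₀
      hH hG hz)
    congr 1
    refine (congr($key ((Proj.stalkIso (MvPolynomial.homogeneousSubmodule ι ℂ) y).inv
        (formFraction hH hG hy)))).symm.trans ?_
    refine congrArg (Scheme.stalkClosedPointTo f) (stalkSpecializes_stalkIso_inv
      (MvPolynomial.homogeneousSubmodule ι ℂ) hzy d ⟨H, hH⟩ ⟨G, hG⟩ hy hz)
  obtain ⟨j, hj⟩ : ∃ j, MvPolynomial.X j ∉ y.asHomogeneousIdeal.toIdeal := exists_X_notMem y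
  refine ⟨j, fun k => ?_, fun u => ?_⟩
  · have h1 := eval (X_mem k) (X_mem j) hj
    obtain ⟨a, b, hb, -, hab⟩ := hfrac (h.stalkMap x ((Proj.stalkIso
      (MvPolynomial.homogeneousSubmodule ι ℂ) y).inv (formFraction (X_mem k) (X_mem j) hj)))
    refine ⟨a, b, hb, ?_⟩
    rw [← hab]
    simp only [MvPolynomial.aeval_X] at h1
    rw [← h1]
    ring
  · obtain ⟨s, hs⟩ := h.stalkMap_surjective x (ρ u)
    obtain ⟨q, rfl⟩ : ∃ q, (Proj.stalkIso (MvPolynomial.homogeneousSubmodule ι ℂ) y).inv q = s :=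
      ⟨(Proj.stalkIso (MvPolynomial.homogeneousSubmodule ι ℂ) y).hom s, by simp⟩
    obtain ⟨⟨d, ⟨H, hH⟩, ⟨G, hG⟩, hy⟩, rfl⟩ := HomogeneousLocalization.mk_surjective q
    refine ⟨d, G, H, hG, hH, ?_, ?_⟩
    · refine Eq.trans ?_ (eval hH hG hy)
      congr 1
      refine (congr($hργ u)).symm.trans (congrArg γ hs.symm)
    · have hunit' : IsUnit (formFraction hG (X_pow_mem j d) (X_pow_notMem hj d)) := by
        refine IsUnit.of_mul_eq_one (formFraction (X_pow_mem j d) hG hy) ?_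
        apply HomogeneousLocalization.val_injective
        simp only [formFraction, HomogeneousLocalization.val_mul, HomogeneousLocalization.val_mk,
          Localization.mk_mul, HomogeneousLocalization.val_one]
        rw [← Localization.mk_one, Localization.mk_eq_mk_iff, Localization.r_iff_exists]
        exact ⟨1, by simp; ring⟩
      have h1 := eval hG (X_pow_mem j d) (X_pow_notMem hj d)
      obtain ⟨a, b, hb, ha, hab⟩ := hfrac (h.stalkMap x ((Proj.stalkIso
        (MvPolynomial.homogeneousSubmodule ι ℂ) y).inv
          (formFraction hG (X_pow_mem j d) (X_pow_notMem hj d))))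
      refine ⟨a, b, ha ((hunit'.map (Proj.stalkIso
        (MvPolynomial.homogeneousSubmodule ι ℂ) y).inv.hom).map (h.stalkMap x).hom), hb, ?_⟩
      rw [← hab]
      simp only [map_pow, MvPolynomial.aeval_X] at h1
      rw [← h1]
      ring

end Embedding

/-! ### Charts and torus-valued points of a toric variety -/

section Charts

variable {N : Type} [AddCommGroup N]

/-- The inclusion of the coordinate ring of an affine toric variety into the ring of Laurent
polynomials. -/
def toLaurent (σ : PointedCone ℚ (ℚ ⊗[ℤ] N)) :
    CoordRing σ →+* AddMonoidAlgebra ℂ (N →ₗ[ℤ] ℤ) :=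
  AddMonoidAlgebra.mapDomainRingHom ℂ (dualMonoid σ).subtype

lemma toLaurent_single {σ : PointedCone ℚ (ℚ ⊗[ℤ] N)} (m : dualMonoid σ) (c : ℂ) :
    toLaurent σ (AddMonoidAlgebra.single m c) = AddMonoidAlgebra.single m.1 c := by
  simp [toLaurent]

lemma toLaurent_injective (σ : PointedCone ℚ (ℚ ⊗[ℤ] N)) : Function.Injective (toLaurent σ) :=
  AddMonoidAlgebra.mapDomain_injective Subtype.val_injective

lemma toLaurent_comp_coordMap {σ τ : PointedCone ℚ (ℚ ⊗[ℤ] N)} (h : σ ≤ τ) :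
    (toLaurent σ).comp (coordMap h) = toLaurent τ := by
  refine AddMonoidAlgebra.ringHom_ext (fun r => ?_) (fun m => ?_) <;>
    simp [coordMap_single, toLaurent_single]

lemma coeff_toLaurent {σ : PointedCone ℚ (ℚ ⊗[ℤ] N)} (a : CoordRing σ) (m : dualMonoid σ) :
    (toLaurent σ a).coeff m.1 = a.coeff m := by
  induction a using AddMonoidAlgebra.induction_linear with
  | zero => simp
  | add x y hx hy => simp [hx, hy]
  | single m' c =>
    classical
    rw [toLaurent_single, AddMonoidAlgebra.coeff_single, AddMonoidAlgebra.coeff_single,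
      Finsupp.single_apply, Finsupp.single_apply]
    simp only [Subtype.ext_iff]

lemma mem_dualMonoid_of_mem_support {σ : PointedCone ℚ (ℚ ⊗[ℤ] N)} {a : CoordRing σ}
    {m : N →ₗ[ℤ] ℤ} (hm : m ∈ (toLaurent σ a).coeff.support) : m ∈ dualMonoid σ := by
  classical
  induction a using AddMonoidAlgebra.induction_linear with
  | zero => simp at hm
  | add x y hx hy =>
    rw [map_add] at hm
    exact (Finset.mem_union.1 (Finsupp.support_add hm)).elim hx hy
  | single m' c =>
    rw [toLaurent_single] at hm
    have := Finsupp.support_single_subset hm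
    rw [Finset.mem_singleton] at this
    exact this ▸ m'.2

namespace Fan

variable (F : Fan N)

/-- The affine chart `U_σ ⟶ X_Σ`. -/
def chart (σ : F.cones) : Spec (CommRingCat.of (CoordRing σ.1)) ⟶ F.toricVariety :=
  colimit.ι F.diagram σ

instance (σ : F.cones) : IsOpenImmersion (F.chart σ) :=
  inferInstanceAs (IsOpenImmersion (colimit.ι F.diagram σ))

lemma chart_structureMorphism (σ : F.cones) : F.chart σ ≫ F.structureMorphism =
    Spec.map (CommRingCat.ofHom (algebraMap ℂ (CoordRing σ.1))) :=
  colimit.ι_desc _ _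

lemma affineMap_chart {σ τ : F.cones} (h : τ.1 ≤ σ.1) : affineMap h ≫ F.chart σ = F.chart τ :=
  colimit.w F.diagram (homOfLE h : τ ⟶ σ)

lemma chart_jointly_surjective (x : F.toricVariety) : ∃ (σ : F.cones) (y : _), F.chart σ y = x :=
  Scheme.IsLocallyDirected.ι_jointly_surjective F.diagram x

variable [Module.Free ℤ N] [Module.Finite ℤ N]

/-- The point of `X_Σ` given by a point of the torus with values in `K`. -/
def torusPoint {K : Type} [CommRing K] (φ : AddMonoidAlgebra ℂ (N →ₗ[ℤ] ℤ) →+* K) :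
    Spec (CommRingCat.of K) ⟶ F.toricVariety :=
  Spec.map (CommRingCat.ofHom (φ.comp (toLaurent ⊥))) ≫ F.chart ⟨⊥, F.bot_mem⟩

lemma torusPoint_eq {K : Type} [CommRing K] (φ : AddMonoidAlgebra ℂ (N →ₗ[ℤ] ℤ) →+* K)
    (σ : F.cones) :
    F.torusPoint φ = Spec.map (CommRingCat.ofHom (φ.comp (toLaurent σ.1))) ≫ F.chart σ := by
  rw [torusPoint, ← F.affineMap_chart (σ := σ) (τ := ⟨⊥, F.bot_mem⟩) bot_le, affineMap,
    ← Spec.map_comp_assoc, ← CommRingCat.ofHom_comp, RingHom.comp_assoc, toLaurent_comp_coordMap]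

lemma torusPoint_structureMorphism {K : Type} [CommRing K] [Algebra ℂ K]
    (φ : AddMonoidAlgebra ℂ (N →ₗ[ℤ] ℤ) →ₐ[ℂ] K) :
    F.torusPoint (φ : _ →+* K) ≫ F.structureMorphism =
      Spec.map (CommRingCat.ofHom (algebraMap ℂ K)) := by
  rw [torusPoint, Category.assoc, chart_structureMorphism, ← Spec.map_comp,
    ← CommRingCat.ofHom_comp]
  congr 2
  ext c
  have h : algebraMap ℂ (CoordRing (⊥ : PointedCone ℚ (ℚ ⊗[ℤ] N))) c =
      AddMonoidAlgebra.single 0 c := by simp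
  simp only [RingHom.comp_apply]
  rw [h, toLaurent_single]
  exact φ.commutes c

end Fan

end Charts

/-! ### Completeness -/

section Completeness

attribute [local instance] MvPolynomial.gradedAlgebra

instance isProper_projectiveSpaceMorphism (r : ℕ) :
    IsProper (projectiveSpaceMorphism r) := by
  have : IsScalarTower ℂ (MvPolynomial.homogeneousSubmodule (Fin (r + 1)) ℂ 0)
      (MvPolynomial (Fin (r + 1)) ℂ) :=
    ⟨fun x y z => smul_mul_assoc x (y : MvPolynomial (Fin (r + 1)) ℂ) z⟩
  have : Algebra.FiniteType (MvPolynomial.homogeneousSubmodule (Fin (r + 1)) ℂ 0)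
      (MvPolynomial (Fin (r + 1)) ℂ) :=
    Algebra.FiniteType.of_restrictScalars_finiteType ℂ _ _
  have h : IsClosedImmersion (Spec.map (CommRingCat.ofHom
      (algebraMap ℂ (MvPolynomial.homogeneousSubmodule (Fin (r + 1)) ℂ 0)))) := by
    refine IsClosedImmersion.spec_of_surjective _ ?_
    rintro ⟨P, hP⟩
    refine ⟨MvPolynomial.coeff 0 P, Subtype.ext ?_⟩
    have hP0 : MvPolynomial.homogeneousComponent 0 P = P :=
      MvPolynomial.homogeneousComponent_of_mem hP |>.trans (if_pos rfl)
    rw [MvPolynomial.homogeneousComponent_zero] at hP0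
    exact hP0
  have h1 : IsProper (Proj.toSpecZero (MvPolynomial.homogeneousSubmodule (Fin (r + 1)) ℂ)) :=
    inferInstance
  unfold projectiveSpaceMorphism
  exact MorphismProperty.comp_mem _ _ _ h1 inferInstance

lemma IsProjective.isProper {X : Scheme.{0}} {f : X ⟶ Spec (CommRingCat.of ℂ)}
    (hf : IsProjective f) : IsProper f := by
  obtain ⟨r, i, hi, rfl⟩ := hf
  infer_instance

variable {N : Type} [AddCommGroup N]

/-- The one-parameter subgroup of the torus defined by a lattice point, as a point with values in
the field of Laurent series. -/
def oneParameterSubgroup (v : N) : AddMonoidAlgebra ℂ (N →ₗ[ℤ] ℤ) →ₐ[ℂ] LaurentSeries ℂ :=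
  AddMonoidAlgebra.lift ℂ _ (N →ₗ[ℤ] ℤ)
    { toFun := fun m => HahnSeries.single (m.toAdd v) 1
      map_one' := by simp
      map_mul' := fun m m' => by simp [HahnSeries.single_mul_single] }

lemma oneParameterSubgroup_single (v : N) (m : N →ₗ[ℤ] ℤ) :
    oneParameterSubgroup v (AddMonoidAlgebra.single m 1) = HahnSeries.single (m v) 1 := by
  refine (AddMonoidAlgebra.lift_single _ _ _).trans ?_
  refine (Algebra.smul_def _ _).trans ?_
  rw [map_one, one_mul]
  rfl

variable [Module.Free ℤ N] [Module.Finite ℤ N] in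
/-- The cones of a fan with proper toric variety cover the lattice: the limit at `0` of the
one-parameter subgroup of `v` exists, and it lies in a chart `U_σ` only if `v ∈ σ`. -/
theorem Fan.exists_mem_of_isProper (F : Fan N) [IsProper F.structureMorphism] (v : N) :
    ∃ σ ∈ F.cones, (1 : ℚ) ⊗ₜ[ℤ] v ∈ σ := by
  have hval : ValuativeCriterion F.structureMorphism :=
    (congrFun (congrFun (congrFun IsProper.eq_valuativeCriterion _) _) F.structureMorphism ▸
      ‹IsProper F.structureMorphism› :
      (ValuativeCriterion ⊓ @QuasiCompact ⊓ @QuasiSeparated ⊓ @LocallyOfFiniteType)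
        F.structureMorphism).1.1.1
  let S : ValuativeCommSq F.structureMorphism :=
    { R := PowerSeries ℂ
      K := LaurentSeries ℂ
      i₁ := F.torusPoint (oneParameterSubgroup v : _ →+* LaurentSeries ℂ)
      i₂ := Spec.map (CommRingCat.ofHom (algebraMap ℂ (PowerSeries ℂ)))
      commSq := ⟨by
        rw [torusPoint_structureMorphism, ← Spec.map_comp, ← CommRingCat.ofHom_comp]⟩ }
  obtain ⟨⟨l, hl, -⟩⟩ := (hval.existence S).exists_lift
  obtain ⟨σ, y, hy⟩ := F.chart_jointly_surjective (l (IsLocalRing.closedPoint (PowerSeries ℂ)))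
  -- A chart that contains the image of the closed point contains the whole image.
  have hrange : Set.range l ⊆ Set.range (F.chart σ) := by
    have h1 := Scheme.preimage_eq_top_of_closedPoint_mem (R := CommRingCat.of (PowerSeries ℂ)) l
      (U := (F.chart σ).opensRange) ⟨y, hy⟩
    rintro _ ⟨z, rfl⟩
    have h2 : z ∈ l ⁻¹ᵁ (F.chart σ).opensRange := by rw [h1]; trivial
    exact h2
  obtain ⟨ψ, hψ⟩ := Spec.map_surjective (IsOpenImmersion.lift (F.chart σ) l hrange)
  have hlift := IsOpenImmersion.lift_fac (F.chart σ) l hrange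
  rw [← hψ] at hlift
  rw [← hlift] at hl
  replace hl : _ = F.torusPoint (oneParameterSubgroup v : _ →+* LaurentSeries ℂ) := hl
  rw [F.torusPoint_eq _ σ, ← Category.assoc, cancel_mono, ← Spec.map_comp] at hl
  have hl' := Spec.map_injective hl
  refine ⟨σ.1, σ.2, (tmul_mem_iff_forall_dualMonoid (F.polyhedral _ σ.2)).2 fun m hm => ?_⟩
  have hm' : algebraMap (PowerSeries ℂ) (LaurentSeries ℂ)
      (ψ (AddMonoidAlgebra.single (⟨m, hm⟩ : dualMonoid σ.1) 1)) = HahnSeries.single (m v) 1 := by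
    refine (congr($hl' (AddMonoidAlgebra.single (⟨m, hm⟩ : dualMonoid σ.1) 1))).trans ?_
    change oneParameterSubgroup v (toLaurent _ _) = _
    rw [toLaurent_single, oneParameterSubgroup_single]
  -- A power series has no term of negative degree `m v`.
  by_contra! hneg
  have hc := congrArg (fun f => HahnSeries.coeff f (m v)) hm'
  simp only [HahnSeries.coeff_single_same] at hc
  exact zero_ne_one ((PowerSeries.coeff_coe _ _).trans (if_pos hneg) |>.symm.trans hc)

end Completeness

/-! ### Coprime homogeneous coordinates on the torus -/

section CoprimeCoordinates

attribute [local instance] MvPolynomial.gradedAlgebra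

/-- A nonzero family of elements of the fraction field of a factorial ring is proportional to a
family of elements of the ring without common factor. -/
lemma exists_coprime_multiple {R K ι : Type*} [CommRing R] [IsDomain R]
    [UniqueFactorizationMonoid R] [Field K] [Algebra R K] [IsFractionRing R K] [Finite ι]
    (g : ι → K) (hg : ∃ i, g i ≠ 0) :
    ∃ (f : ι → R) (c : K), c ≠ 0 ∧ (∀ i, algebraMap R K (f i) = c * g i) ∧
      ∀ q b : R, (∀ i, q ∣ b * f i) → q ∣ b := by
  classical
  have := Fintype.ofFinite ι
  let : StrongNormalizationMonoid R := UniqueFactorizationMonoid.strongNormalizationMonoid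
  let : StrongNormalizedGCDMonoid R := UniqueFactorizationMonoid.toStrongNormalizedGCDMonoid R
  obtain ⟨i₀, hi₀⟩ := hg
  obtain ⟨b, hb⟩ := IsLocalization.exist_integer_multiples_of_finite (nonZeroDivisors R) g
  choose h hh using hb
  have hb0 : algebraMap R K b ≠ 0 := IsFractionRing.to_map_ne_zero_of_mem_nonZeroDivisors b.2
  obtain ⟨f, hf, hf1⟩ := Finset.extract_gcd h (s := Finset.univ) ⟨i₀, Finset.mem_univ _⟩
  have hd : algebraMap R K (Finset.univ.gcd h) ≠ 0 := by
    intro h0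
    have h1 := hh i₀
    rw [hf i₀ (Finset.mem_univ _), map_mul, h0, zero_mul, Algebra.smul_def] at h1
    exact mul_ne_zero hb0 hi₀ h1.symm
  refine ⟨f, algebraMap R K b / algebraMap R K (Finset.univ.gcd h), div_ne_zero hb0 hd,
    fun i => ?_, fun q b hq => ?_⟩
  · have h1 := hh i
    rw [hf i (Finset.mem_univ _), map_mul, Algebra.smul_def] at h1
    field_simp
    rw [← h1, mul_comm]
  · have h1 : q ∣ Finset.univ.gcd fun i => b * f i := Finset.dvd_gcd fun i _ => hq i
    rw [Finset.gcd_mul_left, hf1, mul_one] at h1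
    exact (dvd_normalize_iff).1 h1

variable {N : Type} [AddCommGroup N]

/-- The semigroup `σ^∨ ∩ M` of a full cone has no nonzero invertible element. -/
lemma eq_zero_of_add_eq_zero {σ : PointedCone ℚ (ℚ ⊗[ℤ] N)}
    (hσ : ∃ S : Finset N, σ = coneOf (S : Set N)) (hfull : IsFull σ) {m m' : N →ₗ[ℤ] ℤ}
    (hm : m ∈ dualMonoid σ) (hm' : m' ∈ dualMonoid σ) (h : m + m' = 0) : m = 0 := by
  obtain ⟨v, hv, hv'⟩ := exists_interior_point hσ hfull
  refine hv' m hm ?_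
  have h1 := apply_nonneg hm hv
  have h2 := apply_nonneg hm' hv
  have h3 : m v + m' v = 0 := by rw [← LinearMap.add_apply, h, LinearMap.zero_apply]
  omega

/-- The evaluation of regular functions on `U_σ` at the torus-fixed point, for a full cone `σ`. -/
def fixedPointEval {σ : PointedCone ℚ (ℚ ⊗[ℤ] N)}
    (hσ : ∃ S : Finset N, σ = coneOf (S : Set N)) (hfull : IsFull σ) : CoordRing σ →ₐ[ℂ] ℂ := by
  classical
  exact AddMonoidAlgebra.lift ℂ ℂ (dualMonoid σ)
    { toFun := fun m => if m.toAdd = 0 then 1 else 0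
      map_one' := if_pos rfl
      map_mul' := fun m m' => by
        have h : m.toAdd + m'.toAdd = 0 ↔ m.toAdd = 0 ∧ m'.toAdd = 0 := by
          refine ⟨fun h => ?_, fun h => by rw [h.1, h.2, add_zero]⟩
          have h1 : m.toAdd = 0 := Subtype.ext (eq_zero_of_add_eq_zero hσ hfull m.toAdd.2
            m'.toAdd.2 (congrArg Subtype.val h))
          rw [h1, zero_add] at h
          exact ⟨h1, h⟩
        simp only [toAdd_mul, h]
        split_ifs <;> simp_all }

lemma fixedPointEval_apply {σ : PointedCone ℚ (ℚ ⊗[ℤ] N)}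
    (hσ : ∃ S : Finset N, σ = coneOf (S : Set N)) (hfull : IsFull σ) (a : CoordRing σ) :
    fixedPointEval hσ hfull a = a.coeff 0 := by
  classical
  induction a using AddMonoidAlgebra.induction_linear with
  | zero => simp
  | add x y hx hy => simp [hx, hy]
  | single m c =>
    rw [fixedPointEval, AddMonoidAlgebra.coeff_single, Finsupp.single_apply]
    refine (AddMonoidAlgebra.lift_single _ _ _).trans ?_
    change c • (if m = 0 then (1 : ℂ) else 0) = _
    split_ifs <;> simp

lemma pointCoord_self {ι K : Type} [Field K]
    (f : Spec (CommRingCat.of K) ⟶ Proj (MvPolynomial.homogeneousSubmodule ι ℂ)) {k₀ : ι}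
    (hk₀ : MvPolynomial.X k₀ ∉ (f (IsLocalRing.closedPoint K)).asHomogeneousIdeal.toIdeal) :
    pointCoord f hk₀ k₀ = 1 := by
  rw [pointCoord, ← map_one (pointEval f)]
  congr 1
  apply HomogeneousLocalization.val_injective
  rw [HomogeneousLocalization.val_one]
  exact Localization.mk_self (⟨MvPolynomial.X k₀, hk₀⟩ : Ideal.primeCompl _)

variable [Module.Free ℤ N] [Module.Finite ℤ N]

instance : TwoUniqueSums (N →ₗ[ℤ] ℤ) := twoUniqueSums_of_free

instance : IsDomain (AddMonoidAlgebra ℂ (N →ₗ[ℤ] ℤ)) := NoZeroDivisors.to_isDomain _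

instance : UniqueFactorizationMonoid (AddMonoidAlgebra ℂ (N →ₗ[ℤ] ℤ)) :=
  uniqueFactorizationMonoid_addMonoidAlgebra ℂ

/-- A projective toric variety has homogeneous coordinates that are Laurent polynomials without
common factor. At the torus-fixed point of the chart of a full cone, the ratios of the coordinates
to a suitable one of them are regular, and every character in `σ^∨ ∩ M` is a ratio of forms in the
coordinates whose denominator is, at that point, a unit multiple of a power of that coordinate. The
functions that are regular and nonzero there are those with nonzero constant coefficient. -/
theorem Fan.exists_homogeneous_coordinates (F : Fan N) (hF : IsProjective F.structureMorphism) :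
    ∃ (r : ℕ) (f : Fin (r + 1) → AddMonoidAlgebra ℂ (N →ₗ[ℤ] ℤ)),
      (∀ q b, (∀ k, q ∣ b * f k) → q ∣ b) ∧
      ∀ σ ∈ F.cones, IsFull σ → ∃ j, f j ≠ 0 ∧
        (∀ k, ∃ a b : CoordRing σ, b.coeff 0 ≠ 0 ∧ toLaurent σ b * f k = toLaurent σ a * f j) ∧
        ∀ u ∈ dualMonoid σ, ∃ (d : ℕ) (G H : MvPolynomial (Fin (r + 1)) ℂ),
          G.IsHomogeneous d ∧ H.IsHomogeneous d ∧
          AddMonoidAlgebra.single u 1 * MvPolynomial.aeval f G = MvPolynomial.aeval f H ∧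
          ∃ a b : CoordRing σ, a.coeff 0 ≠ 0 ∧ b.coeff 0 ≠ 0 ∧
            toLaurent σ b * MvPolynomial.aeval f G = toLaurent σ a * f j ^ d := by
  obtain ⟨r, i, hi, hir⟩ := hF
  let R := AddMonoidAlgebra ℂ (N →ₗ[ℤ] ℤ)
  let K := FractionRing R
  let ψ : R →ₐ[ℂ] K := IsScalarTower.toAlgHom ℂ R K
  let e : Spec (CommRingCat.of K) ⟶ Proj (MvPolynomial.homogeneousSubmodule (Fin (r + 1)) ℂ) :=
    F.torusPoint (ψ : R →+* K) ≫ i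
  have he : e ≫ projectiveSpaceMorphism r = Spec.map (CommRingCat.ofHom (algebraMap ℂ K)) := by
    rw [← F.torusPoint_structureMorphism ψ, ← hir]
    exact Category.assoc _ _ _
  obtain ⟨k₀, hk₀⟩ := exists_X_notMem (e (IsLocalRing.closedPoint K))
  let g := pointCoord e hk₀
  have hg₀ : g k₀ = 1 := pointCoord_self e hk₀
  obtain ⟨f, c, hc, hf, hcop⟩ := exists_coprime_multiple (R := R) g
    ⟨k₀, by rw [hg₀]; exact one_ne_zero⟩
  have hinj : Function.Injective (algebraMap R K) := IsFractionRing.injective R K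
  have haeval : ∀ {d : ℕ} {G : MvPolynomial (Fin (r + 1)) ℂ}, G.IsHomogeneous d →
      algebraMap R K (MvPolynomial.aeval f G) = c ^ d * MvPolynomial.aeval g G := by
    intro d G hG
    rw [MvPolynomial.aeval_def g, ← eval₂_mul_of_isHomogeneous _ _ _ hG]
    simp only [← hf]
    exact MvPolynomial.map_aeval f _ G |>.trans (by rfl)
  refine ⟨r, f, hcop, fun σ hσ hfull => ?_⟩
  have hpol := F.polyhedral σ hσ
  let : Algebra (CoordRing σ) K := ((ψ : R →+* K).comp (toLaurent σ)).toAlgebra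
  have halg : ∀ a : CoordRing σ, algebraMap (CoordRing σ) K a = algebraMap R K (toLaurent σ a) :=
    fun a => rfl
  let h : Spec (CommRingCat.of (CoordRing σ)) ⟶
    Proj (MvPolynomial.homogeneousSubmodule (Fin (r + 1)) ℂ) := F.chart ⟨σ, hσ⟩ ≫ i
  have hh : Spec.map (CommRingCat.ofHom (algebraMap (CoordRing σ) K)) ≫ h = e := by
    change _ ≫ F.chart ⟨σ, hσ⟩ ≫ i = F.torusPoint (ψ : R →+* K) ≫ i
    rw [F.torusPoint_eq _ ⟨σ, hσ⟩, Category.assoc]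
  have hsurj : SurjectiveOnStalks h :=
    inferInstanceAs (SurjectiveOnStalks (F.chart ⟨σ, hσ⟩ ≫ i))
  let p : PrimeSpectrum (CoordRing σ) :=
    ⟨RingHom.ker (fixedPointEval hpol hfull), RingHom.ker_isPrime _⟩
  have hp : ∀ a : CoordRing σ, a ∉ p.asIdeal ↔ a.coeff 0 ≠ 0 := fun a => by
    rw [← fixedPointEval_apply hpol hfull]
    exact not_congr RingHom.mem_ker
  have hA : Function.Injective (algebraMap (CoordRing σ) K) := fun a b hab =>
    toLaurent_injective σ (hinj hab)
  obtain ⟨j, hj, hju⟩ := pointCoord_chart e he hk₀ hA h hh p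
  simp only [hp, halg] at hj hju
  refine ⟨j, ?_, fun k => ?_, fun u hu => ?_⟩
  · intro h0
    have h1 : g j = 0 := by
      have := hf j
      rw [h0, map_zero] at this
      exact (mul_eq_zero.1 this.symm).resolve_left hc
    obtain ⟨a, b, hb, hab⟩ := hj k₀
    change _ * g k₀ = _ * g j at hab
    rw [hg₀, h1, mul_zero, mul_one, map_eq_zero_iff _ hinj,
      map_eq_zero_iff _ (toLaurent_injective σ)] at hab
    exact hb (by rw [hab]; rfl)
  · obtain ⟨a, b, hb, hab⟩ := hj k
    refine ⟨a, b, hb, hinj ?_⟩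
    rw [map_mul, map_mul, hf, hf, mul_left_comm, mul_left_comm _ c]
    exact congrArg _ hab
  · obtain ⟨d, G, H, hG, hH, hGH, a, b, ha, hb, hab⟩ := hju (AddMonoidAlgebra.single ⟨u, hu⟩ 1)
    refine ⟨d, G, H, hG, hH, hinj ?_, a, b, ha, hb, hinj ?_⟩
    · rw [toLaurent_single] at hGH
      rw [map_mul, haeval hG, haeval hH, mul_left_comm]
      exact congrArg _ hGH
    · rw [map_mul, map_mul, haeval hG, map_pow, hf, mul_pow, mul_left_comm, mul_left_comm _ (c ^ d)]
      exact congrArg _ hab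

end CoprimeCoordinates

/-! ### Smooth affine toric varieties -/

section Regularity

/-- The indecomposable elements of a commutative monoid. -/
def indecomposables (P : Type*) [AddCommMonoid P] : Set P :=
  {h | h ≠ 0 ∧ ∀ a b, h = a + b → a = 0 ∨ b = 0}

/-- A commutative monoid with a positive grading is generated by its indecomposable elements. -/
lemma exists_linearCombination_indecomposables {P : Type*} [AddCommMonoid P] (w : P →+ ℕ)
    (hw : ∀ p, w p = 0 → p = 0) (p : P) :
    ∃ α : indecomposables P →₀ ℕ, Finsupp.linearCombination ℕ Subtype.val α = p := by
  induction hn : w p using Nat.strong_induction_on generalizing p with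
  | _ n ih =>
    by_cases h0 : p = 0
    · exact ⟨0, by rw [h0, map_zero]⟩
    by_cases hp : p ∈ indecomposables P
    · exact ⟨Finsupp.single ⟨p, hp⟩ 1, by simp⟩
    · simp only [indecomposables, Set.mem_ofPred_eq, not_and, not_forall, not_or] at hp
      obtain ⟨a, b, rfl, ha, hb⟩ := hp h0
      have ha' : w a ≠ 0 := fun h => ha (hw a h)
      have hb' : w b ≠ 0 := fun h => hb (hw b h)
      rw [map_add] at hn
      obtain ⟨α, rfl⟩ := ih (w a) (by omega) a rfl
      obtain ⟨β, rfl⟩ := ih (w b) (by omega) b rfl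
      exact ⟨α + β, map_add _ _ _⟩

variable {P : Type} [AddCommMonoid P]

open MvPolynomial in
/-- The indecomposable elements of a positively graded monoid with formally smooth monoid algebra
satisfy no relation: the map from the monoid algebra to `ℂ[y] / (y)²` that sends indecomposable
elements to the variables and their sums to `0` lifts to `ℂ[y] / (y)ᵏ`, and a relation yields an
equality of monomials in `y` modulo higher powers. -/
lemma injective_linearCombination_indecomposables (w : P →+ ℕ) (hw : ∀ p, w p = 0 → p = 0)
    [Algebra.FormallySmooth ℂ (AddMonoidAlgebra ℂ P)] :
    Function.Injective (Finsupp.linearCombination ℕ (Subtype.val : indecomposables P → P)) := by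
  classical
  let I := idealOfVars (indecomposables P) ℂ
  let B := MvPolynomial (indecomposables P) ℂ
  have hX : ∀ h : indecomposables P, (X h : B) ∈ I := fun h => Ideal.subset_span ⟨h, rfl⟩
  have hadd : ∀ {a b : P}, a + b = 0 → a = 0 := fun {a b} h => by
    have h1 : w a + w b = 0 := by rw [← map_add, h, map_zero]
    exact hw a (by omega)
  let t : P → B := fun p => if p = 0 then 1 else if hp : p ∈ indecomposables P then X ⟨p, hp⟩ else 0
  have ht : ∀ {p}, p ≠ 0 → t p ∈ I := fun {p} hp => by
    simp only [t, if_neg hp]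
    split_ifs
    · exact hX _
    · exact zero_mem _
  let θ : AddMonoidAlgebra ℂ P →ₐ[ℂ] B ⧸ I ^ 2 := AddMonoidAlgebra.lift ℂ _ P
    { toFun := fun p => Ideal.Quotient.mk (I ^ 2) (t p.toAdd)
      map_one' := by simp [t]
      map_mul' := fun p q => by
        change Ideal.Quotient.mk (I ^ 2) (t (p.toAdd + q.toAdd)) = _
        generalize p.toAdd = p
        generalize q.toAdd = q
        rw [← map_mul]
        by_cases hp : p = 0
        · simp [hp, t]
        by_cases hq : q = 0
        · simp [hq, t]
        have hpq : p + q ≠ 0 := fun h => hp (hadd h)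
        have hpq' : p + q ∉ indecomposables P := fun h => (h.2 p q rfl).elim hp hq
        have h1 : t (p + q) = 0 := by simp [t, hpq, hpq']
        rw [h1, map_zero, eq_comm, Ideal.Quotient.eq_zero_iff_mem, pow_two]
        exact Ideal.mul_mem_mul (ht hp) (ht hq) }
  have hθ : ∀ h : indecomposables P, θ (AddMonoidAlgebra.single h.1 1) =
      Ideal.Quotient.mk (I ^ 2) (X h) := fun h => by
    refine (AddMonoidAlgebra.lift_single _ _ _).trans ?_
    rw [one_smul]
    change Ideal.Quotient.mk (I ^ 2) (t h.1) = _
    simp only [t, if_neg h.2.1, dif_pos h.2]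
  -- A lift modulo a power of `I` sends `h` to `X h` up to elements of `I ^ 2`.
  have key : ∀ n, ∃ z : indecomposables P → B, (∀ h, z h - X h ∈ I ^ 2) ∧
      ∀ α β : indecomposables P →₀ ℕ, Finsupp.linearCombination ℕ Subtype.val α =
        Finsupp.linearCombination ℕ (Subtype.val : indecomposables P → P) β →
        (α.prod fun h a => z h ^ a) - (β.prod fun h a => z h ^ a) ∈ I ^ (n + 2) := by
    intro n
    let g : B ⧸ I ^ (n + 2) →ₐ[ℂ] B ⧸ I ^ 2 :=
      Ideal.Quotient.factorₐ ℂ (Ideal.pow_le_pow_right (by omega))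
    have hg : Function.Surjective g :=
      Ideal.Quotient.factor_surjective (Ideal.pow_le_pow_right (by omega))
    have hker : IsNilpotent (RingHom.ker (g : B ⧸ I ^ (n + 2) →+* B ⧸ I ^ 2)) := by
      refine ⟨n + 2, ?_⟩
      change RingHom.ker (Ideal.Quotient.factor
        (show I ^ (n + 2) ≤ I ^ 2 from Ideal.pow_le_pow_right (by omega))) ^ _ = _
      rw [Ideal.Quotient.factor_ker (Ideal.pow_le_pow_right (show 2 ≤ n + 2 by omega)),
        ← Ideal.map_pow, ← pow_mul, Ideal.zero_eq_bot, Ideal.map_eq_bot_iff_le_ker, Ideal.mk_ker]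
      exact Ideal.pow_le_pow_right (by omega)
    let L := Algebra.FormallySmooth.liftOfSurjective θ g hg hker
    have hL : ∀ x, g (L x) = θ x := Algebra.FormallySmooth.liftOfSurjective_apply θ g hg hker
    choose z hz using fun h : indecomposables P =>
      Ideal.Quotient.mk_surjective (L (AddMonoidAlgebra.single h.1 1))
    have hprod : ∀ α : indecomposables P →₀ ℕ, Ideal.Quotient.mk (I ^ (n + 2))
        (α.prod fun h a => z h ^ a) =
        L (AddMonoidAlgebra.single (Finsupp.linearCombination ℕ Subtype.val α) 1) := by
      intro α
      induction α using Finsupp.induction_linear with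
      | zero => simp [AddMonoidAlgebra.one_def.symm]
      | add α β hα hβ =>
        rw [Finsupp.prod_add_index' (by simp) (by simp [pow_add]), map_mul, hα, hβ, ← map_mul,
          AddMonoidAlgebra.single_mul_single, mul_one, map_add]
      | single h a =>
        rw [Finsupp.prod_single_index (by simp), map_pow, hz, ← map_pow,
          AddMonoidAlgebra.single_pow, one_pow, Finsupp.linearCombination_single]
    refine ⟨z, fun h => ?_, fun α β hαβ => ?_⟩
    · rw [← Ideal.Quotient.mk_eq_mk_iff_sub_mem, ← hθ, ← hL, ← hz]
      rfl
    · rw [← Ideal.Quotient.mk_eq_mk_iff_sub_mem, hprod, hprod, hαβ]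
  have hmon : ∀ (z : indecomposables P → B), (∀ h, z h - X h ∈ I ^ 2) →
      ∀ α : indecomposables P →₀ ℕ,
        (α.prod fun h a => z h ^ a) - monomial α 1 ∈ I ^ (α.degree + 1) := by
    intro z hz α
    have hadd' : ∀ α β : indecomposables P →₀ ℕ,
        (α.prod fun h a => z h ^ a) - monomial α 1 ∈ I ^ (α.degree + 1) →
        (β.prod fun h a => z h ^ a) - monomial β 1 ∈ I ^ (β.degree + 1) →
        ((α + β).prod fun h a => z h ^ a) - monomial (α + β) 1 ∈ I ^ ((α + β).degree + 1) := by
      intro α β hα hβ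
      have hα' : (monomial α (1 : ℂ)) ∈ I ^ α.degree :=
        (monomial_mem_pow_idealOfVars_iff _ _ one_ne_zero).2 le_rfl
      have hβ' : (monomial β (1 : ℂ)) ∈ I ^ β.degree :=
        (monomial_mem_pow_idealOfVars_iff _ _ one_ne_zero).2 le_rfl
      have hα'' := add_mem (Ideal.pow_le_pow_right (Nat.le_succ _) hα) hα'
      rw [sub_add_cancel] at hα''
      have h1 := Ideal.mul_mem_mul hα'' hβ
      have h2 := Ideal.mul_mem_mul hα hβ'
      rw [← pow_add] at h1 h2
      rw [map_add, Finsupp.prod_add_index' (by simp) (by simp [pow_add])]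
      have h3 : (monomial (α + β) (1 : ℂ)) = monomial α 1 * monomial β 1 := by
        rw [monomial_mul, one_mul]
      rw [h3]
      rw [show α.degree + 1 + β.degree = α.degree + β.degree + 1 by ring] at h2
      convert! add_mem h1 h2 using 1
      ring
    induction α using Finsupp.induction_linear with
    | zero => simp
    | add α β hα hβ => exact hadd' α β hα hβ
    | single h a =>
      induction a with
      | zero => simp
      | succ a ih =>
        rw [Finsupp.single_add]
        refine hadd' _ _ ih ?_
        rw [Finsupp.prod_single_index (by simp), pow_one, Finsupp.degree_single]
        exact hz h
  have hle : ∀ α β : indecomposables P →₀ ℕ, α.degree ≤ β.degree →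
      Finsupp.linearCombination ℕ Subtype.val α =
        Finsupp.linearCombination ℕ (Subtype.val : indecomposables P → P) β → α = β := by
    intro α β hd hαβ
    obtain ⟨z, hz, hzz⟩ := key α.degree
    have h1 := hmon z hz α
    have h2 := Ideal.pow_le_pow_right (show α.degree + 1 ≤ β.degree + 1 by omega) (hmon z hz β)
    have h3 := Ideal.pow_le_pow_right (show α.degree + 1 ≤ α.degree + 2 by omega) (hzz α β hαβ)
    have h4 := sub_mem (add_mem h3 h2) h1
    have h5 : monomial α (1 : ℂ) - monomial β 1 ∈ I ^ (α.degree + 1) := by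
      convert! h4 using 1
      ring
    by_contra hne
    have h6 := (mem_pow_idealOfVars_iff' _ _).1 h5 α (Nat.lt_succ_self _)
    rw [coeff_sub, coeff_monomial, coeff_monomial, if_pos rfl, if_neg (Ne.symm hne), sub_zero] at h6
    exact one_ne_zero h6
  intro α β hαβ
  rcases le_total α.degree β.degree with h | h
  · exact hle α β h hαβ
  · exact (hle β α h hαβ.symm).symm

variable {N : Type} [AddCommGroup N]

lemma Fan.formallySmooth_coordRing (F : Fan N) [Smooth F.structureMorphism] (σ : F.cones) :
    Algebra.FormallySmooth ℂ (CoordRing σ.1) := by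
  have h1 : Smooth (F.chart σ ≫ F.structureMorphism) := inferInstance
  rw [F.chart_structureMorphism σ, HasRingHomProperty.Spec_iff (P := @Smooth)] at h1
  have h2 : Algebra.Smooth ℂ (CoordRing σ.1) := RingHom.smooth_algebraMap.1 h1
  infer_instance

variable [Module.Free ℤ N] [Module.Finite ℤ N]

/-- The semigroup `σ^∨ ∩ M` of a strongly convex cone generates `M` as a group. -/
lemma exists_sub_of_stronglyConvex {σ : PointedCone ℚ (ℚ ⊗[ℤ] N)}
    (hσ : ∃ S : Finset N, σ = coneOf (S : Set N)) (hσ' : ∀ v ∈ σ, -v ∈ σ → v = 0)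
    (u : N →ₗ[ℤ] ℤ) : ∃ a ∈ dualMonoid σ, ∃ b ∈ dualMonoid σ, u = a - b := by
  obtain ⟨m, hm, hm0⟩ := exists_dualMonoid_pos hσ hσ'
  obtain ⟨k, hk⟩ := exists_nsmul_add_mem (τ := ⊥) hσ hm (fun v => by
    rw [Submodule.mem_bot]
    refine ⟨?_, fun h => hm0 v h.1 h.2⟩
    rintro rfl
    exact ⟨zero_mem _, map_zero _⟩) (u := u) (fun v hv => by
      rw [(Submodule.mem_bot _).1 hv, map_zero])
  exact ⟨_, hk, k • m, nsmul_mem hm k, by abel⟩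

/-- A full strongly convex cone with smooth affine toric variety is generated by a basis of the
lattice. -/
theorem exists_basis_of_formallySmooth {σ : PointedCone ℚ (ℚ ⊗[ℤ] N)}
    (hσ : ∃ S : Finset N, σ = coneOf (S : Set N)) (hσ' : ∀ v ∈ σ, -v ∈ σ → v = 0)
    (hfull : IsFull σ) [Algebra.FormallySmooth ℂ (CoordRing σ)] :
    ∃ (ι : Type) (_ : Finite ι) (e : Module.Basis ι ℤ N), σ = coneOf (Set.range e) := by
  classical
  obtain ⟨v₀, hv₀, hv₀'⟩ := exists_interior_point hσ hfull
  let w : dualMonoid σ →+ ℕ :=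
    { toFun := fun m => (m.1 v₀).toNat
      map_zero' := by simp
      map_add' := fun a b => by
        have h1 := apply_nonneg a.2 hv₀
        have h2 := apply_nonneg b.2 hv₀
        change (a.1 v₀ + b.1 v₀).toNat = _
        exact Int.toNat_add h1 h2 }
  have hw : ∀ p, w p = 0 → p = 0 := fun p hp => by
    have h1 := apply_nonneg p.2 hv₀
    have h2 : (p.1 v₀).toNat = 0 := hp
    exact Subtype.ext (hv₀' p.1 p.2 (by omega))
  let c : indecomposables (dualMonoid σ) → (N →ₗ[ℤ] ℤ) := fun h => h.1.1
  have hcomb : ∀ α : indecomposables (dualMonoid σ) →₀ ℕ,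
      ((Finsupp.linearCombination ℕ Subtype.val α : dualMonoid σ) : N →ₗ[ℤ] ℤ) =
        Finsupp.linearCombination ℤ c (α.mapRange Int.ofNat rfl) := by
    intro α
    induction α using Finsupp.induction_linear with
    | zero => simp
    | add α β hα hβ =>
      rw [map_add, Finsupp.mapRange_add (by simp), map_add, ← hα, ← hβ]
      rfl
    | single h a => simp [c]
  have hli : LinearIndependent ℤ c := by
    rw [linearIndependent_iff]
    intro l hl
    have hsplit : l = (l.mapRange Int.toNat rfl).mapRange Int.ofNat rfl -
        ((-l).mapRange Int.toNat rfl).mapRange Int.ofNat rfl := by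
      ext i
      simp
    have h1 : l.mapRange Int.toNat rfl = (-l).mapRange Int.toNat rfl := by
      refine injective_linearCombination_indecomposables w hw (Subtype.ext ?_)
      rw [hcomb, hcomb]
      rw [hsplit, map_sub, sub_eq_zero] at hl
      exact hl
    rw [hsplit, h1, sub_self]
  have hspan : ⊤ ≤ Submodule.span ℤ (Set.range c) := by
    rintro u -
    rw [Finsupp.mem_span_range_iff_exists_finsupp]
    obtain ⟨a, ha, b, hb, rfl⟩ := exists_sub_of_stronglyConvex hσ hσ' u
    obtain ⟨α, hα⟩ := exists_linearCombination_indecomposables w hw ⟨a, ha⟩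
    obtain ⟨β, hβ⟩ := exists_linearCombination_indecomposables w hw ⟨b, hb⟩
    refine ⟨α.mapRange Int.ofNat rfl - β.mapRange Int.ofNat rfl, ?_⟩
    change Finsupp.linearCombination ℤ c _ = _
    rw [map_sub, ← hcomb, ← hcomb, hα, hβ]
  let b := Module.Basis.mk hli hspan
  have hfin : Finite (indecomposables (dualMonoid σ)) := Module.Finite.finite_basis b
  let e := b.dualBasis.map (Module.evalEquiv ℤ N).symm
  have he : ∀ (m : N →ₗ[ℤ] ℤ) i, m (e i) = b.repr m i := fun m i => by
    rw [Module.Basis.map_apply, Module.apply_evalEquiv_symm_apply, b.dualBasis_apply]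
  have hdual : dualMonoid (coneOf (Set.range e)) = dualMonoid σ := by
    ext m
    rw [mem_dualMonoid_coneOf, Set.forall_mem_range]
    simp only [he]
    constructor
    · intro h
      rw [← b.linearCombination_repr m, Finsupp.linearCombination_apply]
      refine sum_mem fun i _ => ?_
      change b.repr m i • b i ∈ _
      rw [← Int.toNat_of_nonneg (h i), natCast_zsmul, Module.Basis.mk_apply]
      exact nsmul_mem i.1.2 _
    · intro h i
      obtain ⟨α, hα⟩ := exists_linearCombination_indecomposables w hw ⟨m, h⟩
      have h1 : m = Finsupp.linearCombination ℤ b (α.mapRange Int.ofNat rfl) := by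
        rw [Module.Basis.coe_mk, ← hcomb, hα]
      rw [h1, b.repr_linearCombination]
      simp
  refine ⟨_, hfin, e, SetLike.ext fun v => ?_⟩
  have hpol : ∃ S : Finset N, coneOf (Set.range e) = coneOf (S : Set N) :=
    ⟨(Set.finite_range e).toFinset, by simp⟩
  rw [mem_iff_forall_dualMonoid hσ, mem_iff_forall_dualMonoid hpol, hdual]

end Regularity

/-! ### The strictly concave support function -/

section SupportFunction

lemma SupportedInSums.sub_nsmul_mem {M : Type*} [AddCommGroup M] {k : Type*} [Semiring k]
    {S : Set M} {d : ℕ} {f : AddMonoidAlgebra k M} (hf : SupportedInSums S d f)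
    {C : AddSubmonoid M} {m : M} (hC : ∀ t ∈ S, t - m ∈ C) {y : M} (hy : y ∈ f.coeff.support) :
    y - d • m ∈ C := by
  obtain ⟨T, rfl, hT, rfl⟩ := hf y hy
  have h : T.sum - T.card • m = (T.map fun t => t - m).sum := by
    rw [Multiset.sum_map_sub, Multiset.map_id', Multiset.map_const', Multiset.sum_replicate]
  rw [h]
  refine AddSubmonoid.multiset_sum_mem _ _ fun x hx => ?_
  obtain ⟨t, ht, rfl⟩ := Multiset.mem_map.1 hx
  exact hC t (hT t ht)

variable {N : Type} [AddCommGroup N] [Module.Free ℤ N] [Module.Finite ℤ N]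

/-- A projective toric variety carries an integral function on the lattice that is concave, linear
on each full cone, and strictly concave across different full cones: the least order of vanishing of
the homogeneous coordinates along a one-parameter subgroup. -/
theorem Fan.exists_strictlyConcave (F : Fan N) (hF : IsProjective F.structureMorphism) :
    ∃ φ : N → ℤ, φ 0 = 0 ∧ (∀ v w, φ v + φ w ≤ φ (v + w)) ∧
      ∀ σ ∈ F.cones, IsFull σ → ∃ m : N →ₗ[ℤ] ℤ,
        (∀ v, φ v ≤ m v) ∧ ∀ v, φ v = m v ↔ (1 : ℚ) ⊗ₜ[ℤ] v ∈ σ := by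
  classical
  obtain ⟨r, f, hcop, hf⟩ := F.exists_homogeneous_coordinates hF
  let S : Finset (N →ₗ[ℤ] ℤ) := Finset.univ.biUnion fun k => (f k).coeff.support
  have hmemS : ∀ k, ∀ m ∈ (f k).coeff.support, m ∈ S := fun k m hm =>
    Finset.mem_biUnion.2 ⟨k, Finset.mem_univ k, hm⟩
  have hS : S.Nonempty := by
    by_contra hS
    rw [Finset.not_nonempty_iff_eq_empty] at hS
    have h0 : ∀ k, f k = 0 := fun k => by
      by_contra hk
      obtain ⟨m, hm⟩ := Finsupp.support_nonempty_iff.2 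
        (fun h : (f k).coeff = 0 => hk (by ext x; simp [h]))
      have := hmemS k m hm
      simp [hS] at this
    exact one_ne_zero (zero_dvd_iff.1 (hcop 0 1 fun k => by simp [h0]))
  let ev : N → ((N →ₗ[ℤ] ℤ) →+ ℤ) := fun v => (LinearMap.applyₗ v).toAddMonoidHom
  have hev : ∀ v m, ev v m = m v := fun _ _ => rfl
  refine ⟨fun v => S.inf' hS fun m => m v, ?_, fun v w => ?_, fun σ hσ hfull => ?_⟩
  · simp
  · refine Finset.le_inf' _ _ fun m hm => ?_
    rw [map_add]
    exact add_le_add (Finset.inf'_le _ hm) (Finset.inf'_le _ hm)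
  have hpol := F.polyhedral σ hσ
  obtain ⟨j, hj, hrel, hreg⟩ := hf σ hσ hfull
  choose a b hb hab using hrel
  -- The common denominator of the ratios to `f j` is divisible by `f j`.
  have hdvd : f j ∣ toLaurent σ (∏ k, b k) := by
    refine hcop _ _ fun k => ?_
    rw [← Finset.mul_prod_erase _ _ (Finset.mem_univ k), map_mul, mul_right_comm, hab]
    exact Dvd.dvd.mul_right (Dvd.intro_left _ rfl) _
  have hcoeff : ∀ x : CoordRing σ, x.coeff 0 ≠ 0 → 0 ∈ (toLaurent σ x).coeff.support :=
    fun x hx => by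
      rw [Finsupp.mem_support_iff]
      exact (coeff_toLaurent x 0).trans_ne hx
  have hne : ∀ {x : AddMonoidAlgebra ℂ (N →ₗ[ℤ] ℤ)} {y}, y ∈ x.coeff.support → x ≠ 0 := by
    rintro x y hy rfl
    simp at hy
  have hprod : (∏ k, b k).coeff 0 ≠ 0 := by
    rw [← fixedPointEval_apply hpol hfull, map_prod]
    exact Finset.prod_ne_zero_iff.2 fun k _ => by
      rw [fixedPointEval_apply hpol hfull]
      exact hb k
  obtain ⟨c, hc⟩ := hdvd
  have h0 := hcoeff _ hprod
  have hc0 : c ≠ 0 := by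
    rintro rfl
    rw [mul_zero] at hc
    exact hne h0 hc
  obtain ⟨m, hm, m', hm', hmm'⟩ := Finset.mem_add.1
    (AddMonoidAlgebra.support_coeff_mul_subset (f j) c (hc ▸ h0))
  -- On the lattice points of the cone, `m` is minimal among the exponents of all coordinates.
  have hmin : ∀ v, (1 : ℚ) ⊗ₜ[ℤ] v ∈ σ → ∀ t ∈ S, m v ≤ t v := by
    intro v hv t ht
    have hmj : ∀ x ∈ (f j).coeff.support, m v ≤ x v := by
      obtain ⟨x, hx, y, hy, hxy, hx', hy'⟩ := exists_minimal_add_mem_support (ev v) hj hc0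
      have h1 := apply_nonneg (mem_dualMonoid_of_mem_support (hc ▸ hxy)) hv
      have h2 := hx' m hm
      have h3 := hy' m' hm'
      have h4 : m v + m' v = 0 := by rw [← LinearMap.add_apply, hmm', LinearMap.zero_apply]
      rw [LinearMap.add_apply] at h1
      simp only [hev] at h2 h3 hx'
      intro z hz
      have h5 := hx' z hz
      omega
    obtain ⟨k, -, hk⟩ := Finset.mem_biUnion.1 ht
    have hb0 := hcoeff _ (hb k)
    obtain ⟨x, hx, y, hy, hxy, hx', hy'⟩ :=
      exists_minimal_add_mem_support (ev v) (hne hb0) (hne hk)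
    rw [hab] at hxy
    obtain ⟨p, hp, q, hq, hpq⟩ := Finset.mem_add.1
      (AddMonoidAlgebra.support_coeff_mul_subset _ _ hxy)
    have h1 := apply_nonneg (mem_dualMonoid_of_mem_support hp) hv
    have h2 := hmj q hq
    have h3 := hx' 0 hb0
    have h4 := hy' t hk
    have h5 : p v + q v = x v + y v := by rw [← LinearMap.add_apply, hpq, LinearMap.add_apply]
    simp only [hev, LinearMap.zero_apply] at h3 h4
    omega
  have hdual : ∀ t ∈ (S : Set (N →ₗ[ℤ] ℤ)), t - m ∈ dualMonoid σ := by
    intro t ht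
    obtain ⟨T, rfl⟩ := hpol
    rw [mem_dualMonoid_coneOf]
    intro s hs
    have := hmin s (tmul_mem_coneOf hs) t ht
    rw [LinearMap.sub_apply]
    omega
  refine ⟨m, fun v => Finset.inf'_le _ (hmemS j m hm), fun v => ⟨fun hv => ?_, fun hv =>
    le_antisymm (Finset.inf'_le _ (hmemS j m hm)) (Finset.le_inf' _ _ (hmin v hv))⟩⟩
  rw [tmul_mem_iff_forall_dualMonoid hpol]
  intro u hu
  obtain ⟨d, G, H, hG, hH, hGH, a', b', ha', hb', hab'⟩ := hreg u hu
  obtain ⟨v₀, hv₀, hv₀'⟩ := exists_interior_point hpol hfull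
  have ha0 := hcoeff _ ha'
  -- The character `d • m` occurs in the denominator `G`, as seen by its order at an interior point.
  have hdm : d • m ∈ (MvPolynomial.aeval f G).coeff.support := by
    obtain ⟨z, hz, hz'⟩ := exists_mem_support_pow (ev v₀) ⟨m, hm, le_rfl⟩ d
    obtain ⟨x, hx, y, hy, hxy, hx', hy'⟩ :=
      exists_minimal_add_mem_support (ev v₀) (hne ha0) (hne hz)
    rw [← hab'] at hxy
    obtain ⟨p, hp, q, hq, hpq⟩ := Finset.mem_add.1
      (AddMonoidAlgebra.support_coeff_mul_subset _ _ hxy)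
    have h1 := apply_nonneg (mem_dualMonoid_of_mem_support hp) hv₀
    have h2 := hx' 0 ha0
    have h3 := hy' z hz
    have h4 : p v₀ + q v₀ = x v₀ + y v₀ := by
      rw [← LinearMap.add_apply, hpq, LinearMap.add_apply]
    simp only [hev, LinearMap.zero_apply] at h2 h3 hz'
    have h5 := (supportedInSums_aeval f hmemS hG).sub_nsmul_mem hdual hq
    have h6 := apply_nonneg h5 hv₀
    have h7 : (q - d • m) v₀ = q v₀ - d * m v₀ := by simp
    have h8 := hv₀' _ h5 (by omega)
    rwa [← sub_eq_zero.1 h8]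
  have hudm : u + d • m ∈ (MvPolynomial.aeval f H).coeff.support := by
    rw [← hGH, AddMonoidAlgebra.support_coeff_single_mul_eq_image _ (by simp)]
    · exact Finset.mem_image_of_mem _ hdm
    · exact fun _ _ h => add_left_cancel h
  have h1 := (supportedInSums_aeval f hmemS hH).sub_nsmul_mem (m := m)
    (C := (AddSubmonoid.nonneg ℤ).comap (ev v)) (fun t ht => by
      have := Finset.inf'_le (fun m : N →ₗ[ℤ] ℤ => m v) ht
      change 0 ≤ (t - m) v
      rw [LinearMap.sub_apply]
      exact sub_nonneg.2 (hv.symm.le.trans this)) hudm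
  rw [add_sub_cancel_right] at h1
  exact h1

end SupportFunction

/-! ### Cones generated by a part of a basis -/

section BasisCones

variable {N : Type} [AddCommGroup N] {ι : Type} [Finite ι] (e : Module.Basis ι ℤ N)

omit [Finite ι] in
lemma sum_pair_coord_smul [Fintype ι] (v : ℚ ⊗[ℤ] N) :
    ∑ i, pair (e.coord i) v • ((1 : ℚ) ⊗ₜ[ℤ] e i) = v := by
  induction v using TensorProduct.induction_on with
  | zero => simp
  | add x y hx hy =>
    simp only [map_add, add_smul, Finset.sum_add_distrib]
    rw [hx, hy]
  | tmul q x =>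
    conv_rhs => rw [← e.sum_repr x, TensorProduct.tmul_sum]
    refine Finset.sum_congr rfl fun i _ => ?_
    rw [pair_tmul, TensorProduct.tmul_smul, TensorProduct.smul_tmul', TensorProduct.smul_tmul',
      smul_eq_mul, mul_one, zsmul_eq_mul, mul_comm]
    rfl

lemma mem_coneOf_image {I : Set ι} {v : ℚ ⊗[ℤ] N} : v ∈ coneOf (e '' I) ↔
    (∀ i, 0 ≤ pair (e.coord i) v) ∧ ∀ i ∉ I, pair (e.coord i) v = 0 := by
  classical
  have := Fintype.ofFinite ι
  constructor
  · intro hv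
    induction hv using Submodule.span_induction with
    | mem x hx =>
      obtain ⟨_, ⟨j, hj, rfl⟩, rfl⟩ := hx
      refine ⟨fun i => ?_, fun i hi => ?_⟩
      · simp only [pair_tmul, one_mul, Module.Basis.coord_apply, Module.Basis.repr_self,
          Finsupp.single_apply]
        split_ifs <;> simp
      · have : j ≠ i := fun h => hi (h ▸ hj)
        simp [this]
    | zero => simp
    | add x y _ _ hx hy =>
      refine ⟨fun i => ?_, fun i hi => ?_⟩
      · rw [map_add]
        exact add_nonneg (hx.1 i) (hy.1 i)
      · rw [map_add, hx.2 i hi, hy.2 i hi, add_zero]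
    | smul a x _ hx =>
      have h : a • x = (a : ℚ) • x := rfl
      refine ⟨fun i => ?_, fun i hi => ?_⟩
      · rw [h, map_smul]
        exact mul_nonneg a.2 (hx.1 i)
      · rw [h, map_smul, hx.2 i hi, smul_zero]
  · rintro ⟨h1, h2⟩
    rw [← sum_pair_coord_smul e v]
    refine sum_mem fun i _ => ?_
    by_cases hi : i ∈ I
    · exact Submodule.smul_mem (coneOf (e '' I)) ⟨_, h1 i⟩ (tmul_mem_coneOf ⟨i, hi, rfl⟩)
    · rw [h2 i hi, zero_smul]
      exact zero_mem _

lemma tmul_mem_coneOf_range {v : N} :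
    (1 : ℚ) ⊗ₜ[ℤ] v ∈ coneOf (Set.range e) ↔ ∀ i, 0 ≤ e.repr v i := by
  rw [← Set.image_univ, mem_coneOf_image]
  simp

lemma isFace_coneOf_image (I : Set ι) : IsFace (coneOf (e '' I)) (coneOf (Set.range e)) := by
  classical
  have := Fintype.ofFinite ι
  have hnn : ∀ v ∈ coneOf (Set.range e), ∀ i, 0 ≤ pair (e.coord i) v := fun v hv => by
    rw [← Set.image_univ, mem_coneOf_image] at hv
    exact hv.1
  refine ⟨∑ i with i ∉ I, e.coord i, fun v hv => ?_, fun v => ⟨fun hv => ?_, fun hv => ?_⟩⟩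
  · rw [pair_sum]
    exact Finset.sum_nonneg fun i _ => hnn v hv i
  · rw [mem_coneOf_image] at hv
    rw [← Set.image_univ, mem_coneOf_image, pair_sum]
    exact ⟨⟨hv.1, by simp⟩, Finset.sum_eq_zero fun i hi => hv.2 i (Finset.mem_filter.1 hi).2⟩
  · rw [mem_coneOf_image]
    refine ⟨hnn v hv.1, fun i hi => ?_⟩
    have h := hv.2
    rw [pair_sum, Finset.sum_eq_zero_iff_of_nonneg fun i _ => hnn v hv.1 i] at h
    exact h i (by simpa using hi)

lemma span_coneOf (S : Set N) : Submodule.span ℚ (coneOf S : Set (ℚ ⊗[ℤ] N)) =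
    Submodule.span ℚ ((fun x : N => (1 : ℚ) ⊗ₜ[ℤ] x) '' S) := by
  refine le_antisymm (Submodule.span_le.2 fun v hv => ?_)
    (Submodule.span_mono PointedCone.subset_hull)
  induction hv using Submodule.span_induction with
  | mem x hx => exact Submodule.subset_span hx
  | zero => exact zero_mem _
  | add x y _ _ hx hy => exact add_mem hx hy
  | smul a x _ hx => exact Submodule.smul_mem _ (a : ℚ) hx

omit [Finite ι] in
lemma coneDim_coneOf_image (I : Finset ι) : coneDim (coneOf (e '' I)) = I.card := by
  classical
  have h : (fun x : N => (1 : ℚ) ⊗ₜ[ℤ] x) '' (e '' I) =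
      Set.range (e.baseChange ℚ ∘ (Subtype.val : I → ι)) := by
    ext v
    simp [Module.Basis.baseChange_apply]
  rw [coneDim, span_coneOf, h, finrank_span_eq_card
    ((e.baseChange ℚ).linearIndependent.comp _ Subtype.val_injective), Fintype.card_coe]

namespace Fan

variable {e} {F : Fan N}

lemma generatesCone_of_subset_range (he : coneOf (Set.range e) ∈ F.cones) {P : Finset N}
    (hP : (P : Set N) ⊆ Set.range e) : F.GeneratesCone P P.card := by
  classical
  have := Fintype.ofFinite ι
  obtain ⟨I, hI⟩ : ∃ I : Finset ι, P = I.image e :=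
    ⟨P.preimage e (Function.Injective.injOn e.injective), by
      rw [Finset.image_preimage]
      exact (Finset.filter_true_of_mem fun x hx => hP hx).symm⟩
  have hIc : (P : Set N) = e '' I := by rw [hI, Finset.coe_image]
  refine ⟨?_, ?_⟩
  · rw [hIc]
    exact F.face_mem _ he _ (isFace_coneOf_image e I)
  · rw [hIc, coneDim_coneOf_image, hI, Finset.card_image_of_injective _ e.injective]

lemma basis_mem_generators (he : coneOf (Set.range e) ∈ F.cones) (i : ι) :
    e i ∈ F.generators := by
  classical
  refine ⟨coneOf (e '' ({i} : Finset ι)), F.face_mem _ he _ (isFace_coneOf_image e _),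
    by rw [coneDim_coneOf_image, Finset.card_singleton], fun y => ?_⟩
  rw [mem_coneOf_image]
  simp only [pair_tmul, one_mul, Finset.coe_singleton, Set.mem_singleton_iff,
    Module.Basis.coord_apply, Int.cast_nonneg_iff, Int.cast_eq_zero]
  constructor
  · rintro ⟨h1, h2⟩
    refine ⟨(e.repr y i).toNat, e.repr.injective ?_⟩
    ext k
    rw [map_nsmul, Finsupp.smul_apply, Module.Basis.repr_self, Finsupp.single_apply]
    split_ifs with h
    · subst h
      simp [h1 i]
    · simp [h2 k (Ne.symm h)]
  · rintro ⟨k, rfl⟩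
    refine ⟨fun l => ?_, fun l hl => ?_⟩
    · rw [map_nsmul, Finsupp.smul_apply, Module.Basis.repr_self, Finsupp.single_apply]
      split_ifs <;> simp
    · simp [Finsupp.single_eq_of_ne hl]

lemma ne_zero_of_mem_generators {x : N} (hx : x ∈ F.generators) : x ≠ 0 := by
  rintro rfl
  obtain ⟨τ, hτ, hdim, hmem⟩ := hx
  obtain ⟨T, rfl⟩ := F.polyhedral τ hτ
  have hT : ∀ t ∈ T, t = 0 := fun t ht => by
    obtain ⟨k, rfl⟩ := (hmem t).1 (tmul_mem_coneOf ht)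
    simp
  have : Submodule.span ℚ ((fun x : N => (1 : ℚ) ⊗ₜ[ℤ] x) '' T) = ⊥ := by
    rw [Submodule.span_eq_bot]
    rintro _ ⟨t, ht, rfl⟩
    simp [hT t ht]
  rw [coneDim, span_coneOf, this, finrank_bot] at hdim
  exact zero_ne_one hdim

/-- The primitive ray generators in a cone of the fan generated by a basis belong to the basis. -/
lemma mem_range_of_mem_generators (he : coneOf (Set.range e) ∈ F.cones) {x : N}
    (hx : x ∈ F.generators) (hxe : (1 : ℚ) ⊗ₜ[ℤ] x ∈ coneOf (Set.range e)) :
    x ∈ Set.range e := by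
  have := Fintype.ofFinite ι
  have hx0 := ne_zero_of_mem_generators hx
  obtain ⟨τ, hτ, -, hmem⟩ := hx
  have hle : τ ≤ coneOf (Set.range e) := by
    obtain ⟨T, rfl⟩ := F.polyhedral τ hτ
    refine Submodule.span_le.2 ?_
    rintro _ ⟨t, ht, rfl⟩
    obtain ⟨k, rfl⟩ := (hmem t).1 (tmul_mem_coneOf ht)
    change (1 : ℚ) ⊗ₜ[ℤ] (k • x) ∈ coneOf (Set.range e)
    rw [TensorProduct.tmul_smul]
    exact nsmul_mem hxe k
  obtain ⟨m, hm, hface⟩ := F.isFace_of_le (σ := ⟨_, he⟩) (τ := ⟨τ, hτ⟩) hle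
  have hmx : m x = 0 := by
    have := ((hface _).1 ((hmem x).2 ⟨1, (one_nsmul x).symm⟩)).2
    simpa using this
  have hme : ∀ i, 0 ≤ m (e i) := fun i => apply_nonneg hm (tmul_mem_coneOf ⟨i, rfl⟩)
  have hxi := (tmul_mem_coneOf_range e).1 hxe
  obtain ⟨i, hi⟩ : ∃ i, e.repr x i ≠ 0 := by
    by_contra! h
    exact hx0 (e.repr.injective (by ext i; simp [h i]))
  have hsum : ∑ i, e.repr x i * m (e i) = 0 := by
    rw [← hmx]
    conv_rhs => rw [← e.sum_repr x, map_sum]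
    simp
  rw [Finset.sum_eq_zero_iff_of_nonneg fun i _ => mul_nonneg (hxi i) (hme i)] at hsum
  have hmi : m (e i) = 0 := (mul_eq_zero.1 (hsum i (Finset.mem_univ i))).resolve_left hi
  obtain ⟨k, hk⟩ := (hmem (e i)).1 ((hface _).2 ⟨tmul_mem_coneOf ⟨i, rfl⟩, by simp [hmi]⟩)
  have h1 : (1 : ℤ) = k * e.repr x i := by
    have := congrArg (fun y => e.repr y i) hk
    simpa using this
  have hk1 : k = 1 := by
    have := Int.eq_one_or_neg_one_of_mul_eq_one h1.symm
    omega
  exact ⟨i, by rw [hk, hk1, one_nsmul]⟩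

end Fan

end BasisCones

/-! ### Relations among the ray generators -/

section Relations

variable {N : Type} [AddCommGroup N] {F : Fan N}

lemma Fan.generatesCone_empty [Module.Free ℤ N] [Module.Finite ℤ N] :
    F.GeneratesCone ((∅ : Finset N) : Set N) (∅ : Finset N).card := by
  have h : coneOf ((∅ : Finset N) : Set N) = ⊥ := by
    rw [coneOf, Finset.coe_empty, Set.image_empty]
    exact Submodule.span_empty
  refine ⟨h ▸ F.bot_mem, ?_⟩
  rw [coneDim, span_coneOf, Finset.coe_empty, Set.image_empty, Submodule.span_empty, finrank_bot,
    Finset.card_empty]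

/-- A finite set of ray generators that does not generate a cone of the fan of the expected
dimension contains a primitive collection. -/
lemma Fan.exists_isPrimitiveCollection_subset [Module.Free ℤ N] [Module.Finite ℤ N]
    {A : Finset N} (hA : (A : Set N) ⊆ F.generators) (hA' : ¬ F.GeneratesCone (A : Set N) A.card) :
    ∃ P ⊆ A, F.IsPrimitiveCollection P := by
  classical
  obtain ⟨P, hPA, hP⟩ := exists_minimal_le_of_wellFoundedLT
    (fun P : Finset N => ¬ F.GeneratesCone (P : Set N) P.card) A hA'
  refine ⟨P, hPA, ?_, fun x hx => hA (hPA hx), fun x hx => ?_, hP.prop⟩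
  · rw [Finset.nonempty_iff_ne_empty]
    rintro rfl
    exact hP.prop F.generatesCone_empty
  · by_contra h
    rw [← Finset.coe_erase, ← Finset.card_erase_of_mem hx] at h
    exact Finset.notMem_erase x P (hP.le_of_le h (Finset.erase_subset x P) hx)

/-- Ray generators that sum to `0` cannot all lie in one strongly convex cone. -/
lemma Fan.coneOf_notMem_of_sum_eq_zero [Module.Free ℤ N] [DecidableEq N] {A : Multiset N}
    (hA : ∀ x ∈ A, x ∈ F.generators) (hA0 : A ≠ 0) (hsum : A.sum = 0) :
    coneOf (A.toFinset : Set N) ∉ F.cones := by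
  intro hmem
  obtain ⟨x, hx⟩ := Multiset.exists_mem_of_ne_zero hA0
  obtain ⟨B, rfl⟩ := Multiset.exists_cons_of_mem hx
  have hall : ∀ y ∈ x ::ₘ B, (1 : ℚ) ⊗ₜ[ℤ] y ∈ coneOf ((x ::ₘ B).toFinset : Set N) :=
    fun y hy => tmul_mem_coneOf (by simpa using hy)
  have hB : (1 : ℚ) ⊗ₜ[ℤ] B.sum ∈ coneOf ((x ::ₘ B).toFinset : Set N) := by
    have h : (1 : ℚ) ⊗ₜ[ℤ] B.sum = (B.map fun y => (1 : ℚ) ⊗ₜ[ℤ] y).sum :=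
      map_multiset_sum (TensorProduct.mk ℤ ℚ N 1) B
    rw [h]
    refine multiset_sum_mem _ fun z hz => ?_
    obtain ⟨y, hy, rfl⟩ := Multiset.mem_map.1 hz
    exact hall y (Multiset.mem_cons_of_mem hy)
  rw [Multiset.sum_cons] at hsum
  rw [eq_neg_of_add_eq_zero_right hsum, TensorProduct.tmul_neg] at hB
  have h0 := F.stronglyConvex _ hmem _ (hall x hx) hB
  refine ne_zero_of_mem_generators (hA x hx) ?_
  let b := Module.Free.chooseBasis ℤ N
  refine b.repr.injective (Finsupp.ext fun i => ?_)
  have h1 := pair_tmul (b.coord i) 1 x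
  rw [h0, map_zero, one_mul] at h1
  simpa using h1.symm

/-- In a complete regular fan, every lattice point is a sum of ray generators that lie in a full
cone with it. -/
lemma Fan.exists_multiset_sum_eq
    (hreg : ∀ σ ∈ F.cones, IsFull σ →
      ∃ (ι : Type) (_ : Finite ι) (e : Module.Basis ι ℤ N), σ = coneOf (Set.range e))
    (hcov : ∀ v : N, ∃ σ ∈ F.cones, IsFull σ ∧ (1 : ℚ) ⊗ₜ[ℤ] v ∈ σ) (v : N) :
    ∃ σ ∈ F.cones, IsFull σ ∧ (1 : ℚ) ⊗ₜ[ℤ] v ∈ σ ∧ ∃ D : Multiset N,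
      (∀ x ∈ D, x ∈ F.generators ∧ (1 : ℚ) ⊗ₜ[ℤ] x ∈ σ) ∧ D.sum = v := by
  obtain ⟨σ, hσ, hfull, hv⟩ := hcov v
  obtain ⟨ι, hι, e, rfl⟩ := hreg σ hσ hfull
  have := Fintype.ofFinite ι
  refine ⟨_, hσ, hfull, hv, ∑ i, Multiset.replicate (e.repr v i).toNat (e i), fun x hx => ?_, ?_⟩
  · obtain ⟨i, -, hi⟩ := Multiset.mem_sum.1 hx
    rw [Multiset.eq_of_mem_replicate hi]
    exact ⟨basis_mem_generators hσ i, tmul_mem_coneOf ⟨i, rfl⟩⟩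
  · have h := (tmul_mem_coneOf_range e).1 hv
    have h1 : (∑ i, Multiset.replicate (e.repr v i).toNat (e i)).sum =
        ∑ i, (Multiset.replicate (e.repr v i).toNat (e i)).sum :=
      map_sum (Multiset.sumAddMonoidHom : Multiset N →+ N) _ _
    rw [h1]
    conv_rhs => rw [← e.sum_repr v]
    refine Finset.sum_congr rfl fun i _ => ?_
    rw [Multiset.sum_replicate, ← natCast_zsmul, Int.toNat_of_nonneg (h i)]

/-- A complete fan in a lattice of positive rank has a nontrivial positive relation between its ray
generators. -/
lemma Fan.exists_relation (hN : 0 < Module.finrank ℤ N)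
    (hreg : ∀ σ ∈ F.cones, IsFull σ →
      ∃ (ι : Type) (_ : Finite ι) (e : Module.Basis ι ℤ N), σ = coneOf (Set.range e))
    (hcov : ∀ v : N, ∃ σ ∈ F.cones, IsFull σ ∧ (1 : ℚ) ⊗ₜ[ℤ] v ∈ σ) :
    ∃ A : Multiset N, (∀ x ∈ A, x ∈ F.generators) ∧ A ≠ 0 ∧ A.sum = 0 := by
  obtain ⟨σ, hσ, hfull, -⟩ := hcov 0
  obtain ⟨ι, hι, e, rfl⟩ := hreg σ hσ hfull
  have := Fintype.ofFinite ι
  obtain ⟨_, -, -, -, D, hD, hDsum⟩ := Fan.exists_multiset_sum_eq hreg hcov (-∑ i, e i)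
  refine ⟨Finset.univ.val.map e + D, fun x hx => ?_, fun h => ?_, ?_⟩
  · rcases Multiset.mem_add.1 hx with hx | hx
    · obtain ⟨i, -, rfl⟩ := Multiset.mem_map.1 hx
      exact basis_mem_generators hσ i
    · exact (hD x hx).1
  · have h1 := congrArg Multiset.card h
    rw [Multiset.card_add, Multiset.card_map, Multiset.card_zero] at h1
    have h2 : Fintype.card ι = 0 := Nat.eq_zero_of_add_eq_zero_right h1
    rw [Module.finrank_eq_card_basis e, h2] at hN
    exact lt_irrefl 0 hN
  · rw [Multiset.sum_add, hDsum]
    exact add_neg_cancel _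

/-- Batyrev's argument: in a nontrivial relation `∑ x = 0` between ray generators that maximizes
`∑ φ x`, a primitive collection `P` can be replaced by the expansion of its sum in a cone, which
increases `∑ φ x`; therefore the relation is `P` and the expansion is empty. -/
theorem Fan.exists_isPrimitiveCollection_sum_eq_zero [Module.Free ℤ N] [Module.Finite ℤ N]
    (hN : 0 < Module.finrank ℤ N)
    (hreg : ∀ σ ∈ F.cones, IsFull σ →
      ∃ (ι : Type) (_ : Finite ι) (e : Module.Basis ι ℤ N), σ = coneOf (Set.range e))
    (hcov : ∀ v : N, ∃ σ ∈ F.cones, IsFull σ ∧ (1 : ℚ) ⊗ₜ[ℤ] v ∈ σ)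
    {φ : N → ℤ} (hφ0 : φ 0 = 0) (hφadd : ∀ v w, φ v + φ w ≤ φ (v + w))
    (hφ : ∀ σ ∈ F.cones, IsFull σ → ∃ m : N →ₗ[ℤ] ℤ,
        (∀ v, φ v ≤ m v) ∧ ∀ v, φ v = m v ↔ (1 : ℚ) ⊗ₜ[ℤ] v ∈ σ) :
    ∃ P : Finset N, F.IsPrimitiveCollection P ∧ ∑ x ∈ P, x = 0 := by
  classical
  have hle : ∀ A : Multiset N, (A.map φ).sum ≤ φ A.sum := fun A => by
    induction A using Multiset.induction_on with
    | empty => simp [hφ0]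
    | cons x A ih =>
      rw [Multiset.map_cons, Multiset.sum_cons, Multiset.sum_cons]
      exact (add_le_add_right ih _).trans (hφadd _ _)
  let W : Multiset N → ℕ := fun A => (-(A.map φ).sum).toNat
  obtain ⟨A, ⟨hA, hA0, hAsum⟩, hmin⟩ := (measure W).wf.has_min
    {A : Multiset N | (∀ x ∈ A, x ∈ F.generators) ∧ A ≠ 0 ∧ A.sum = 0}
    (Fan.exists_relation hN hreg hcov)
  obtain ⟨P, hPA, hP⟩ := Fan.exists_isPrimitiveCollection_subset (F := F) (A := A.toFinset)
    (fun x hx => hA x (by simpa using hx))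
    (fun h => Fan.coneOf_notMem_of_sum_eq_zero hA hA0 hAsum h.1)
  have hPA' : P.val ≤ A := (Finset.val_le_iff.2 hPA).trans (Multiset.dedup_le A)
  obtain ⟨B, rfl⟩ := Multiset.le_iff_exists_add.1 hPA'
  obtain ⟨σ, hσ, hfull, hv, D, hD, hDsum⟩ := Fan.exists_multiset_sum_eq hreg hcov P.val.sum
  obtain ⟨m, hm, hm'⟩ := hφ σ hσ hfull
  have hlin : ∀ T : Multiset N, (T.map m).sum = m T.sum := fun T => (map_multiset_sum m T).symm
  have hDφ : (D.map φ).sum = φ P.val.sum := by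
    rw [Multiset.map_congr rfl fun x hx => (hm' x).2 (hD x hx).2, hlin, hDsum, (hm' _).2 hv]
  have hPφ : (P.val.map φ).sum < φ P.val.sum := by
    rw [(hm' _).2 hv, ← hlin]
    change ∑ x ∈ P, φ x < ∑ x ∈ P, m x
    refine lt_of_le_of_ne (Finset.sum_le_sum fun x _ => hm x) fun heq => hP.not_generates ?_
    rw [Finset.sum_eq_sum_iff_of_le fun x _ => hm x] at heq
    obtain ⟨ι, hι, e, rfl⟩ := hreg σ hσ hfull
    exact Fan.generatesCone_of_subset_range hσ fun x hx =>
      Fan.mem_range_of_mem_generators hσ (hP.subset_generators hx) ((hm' x).1 (heq x hx))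
  have hsum : (D + B).sum = 0 := by
    rw [Multiset.sum_add, hDsum, ← Multiset.sum_add, hAsum]
  have hzero : D + B = 0 := by
    by_contra hne
    refine hmin (D + B) ⟨fun x hx => ?_, hne, hsum⟩ ?_
    · rcases Multiset.mem_add.1 hx with hx | hx
      · exact (hD x hx).1
      · exact hA x (Multiset.mem_add.2 (Or.inr hx))
    · change (-((D + B).map φ).sum).toNat < (-((P.val + B).map φ).sum).toNat
      have h1 := hle (D + B)
      rw [hsum, hφ0] at h1
      rw [Multiset.map_add, Multiset.sum_add, hDφ] at h1 ⊢
      rw [Multiset.map_add, Multiset.sum_add]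
      omega
  refine ⟨P, hP, ?_⟩
  have hD0 : D = 0 := Multiset.le_zero.1 (hzero ▸ Multiset.le_add_right D B)
  change (P.val.map fun x => x).sum = 0
  rw [Multiset.map_id', ← hDsum, hD0, Multiset.sum_zero]

end Relations

end Toric

end

/-- If a fan `F` in a lattice `N` of positive rank defines a projective toric manifold, then there
is a primitive collection `{x₁, …, x_k}` of `F` with `x₁ + ⋯ + x_k = 0`. -/
theorem corollary4p3 {N : Type} [AddCommGroup N] [Module.Free ℤ N] [Module.Finite ℤ N]
    (hN : 0 < Module.finrank ℤ N) (F : Toric.Fan N) (hF : F.DefinesProjectiveManifold) :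
    ∃ P : Finset N, F.IsPrimitiveCollection P ∧ ∑ x ∈ P, x = 0 := by
  have := hF.1
  have := hF.2.isProper
  obtain ⟨φ, hφ0, hφadd, hφ⟩ := F.exists_strictlyConcave hF.2
  refine Toric.Fan.exists_isPrimitiveCollection_sum_eq_zero hN (fun σ hσ hfull => ?_)
    (F.exists_isFull_mem F.exists_mem_of_isProper) hφ0 hφadd hφ
  have := F.formallySmooth_coordRing ⟨σ, hσ⟩
  exact Toric.exists_basis_of_formallySmooth (F.polyhedral σ hσ) (F.stronglyConvex σ hσ) hfull
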